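/- Let $p\ge 2$ be even and $k\ge 2$. For $a\in[k]^p$ put $f(a)=\sum_{i=1}^k\prod_{j=1}^p\bigl(\mathbf 1_{a_j=i}-\tfrac1k\bigr)$. For $0<\epsilon<\theta_0<\tfrac12$ the $p$-marginal HSBM$(n,k,\theta_0,\epsilon)$ consists of two laws of a random $p$-uniform hypergraph $Y=(Y_S)_{S\in\binom{[n]}{p}}$ on $[n]$: under the null law $\mathbb Q$ the $Y_S$ are independent $\mathrm{Bern}(\theta_0)$; under the planted law $\mathbb P$ one first draws $x\in[k]^n$ uniformly and then, independently for each $S=\{s_1<\dots<s_p\}$, $Y_S\sim\mathrm{Bern}\bigl(\theta_0+\epsilon f(x_{s_1},\dots,x_{s_p})\bigr)$. Let $A_S=(Y_S-\theta_0)/\sqrt{\theta_0(1-\theta_0)}$ and $\beta=\epsilon/\sqrt{\theta_0(1-\theta_0)}$. The $\ell$-th order bosonic Kikuchi matrix $\mathcal K$ is indexed by the $\ell$-tuples of distinct elements of $[n]$. For two such tuples $S,V$ let $S\ominus V$ be the tuple that lists the entries of $S$ at the positions where $S$ and $V$ disagree, followed by those of $V$ at the same positions (both in increasing order of position). Then $\mathcal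 K_{S,V}=A_{\{\mu_1,\dots,\mu_p\}}$ if $S\ominus V=(\mu_1,\dots,\mu_p)$ has length $p$ and distinct entries, and $\mathcal K_{S,V}=0$ otherwise. **Theorem.** There is a constant $C=C_{k,p}>0$ depending only on $k$ and $p$ such that the following holds. Let $\theta_0=\theta_0(n)$, $\epsilon=\epsilon(n)$, $\ell=\ell(n)\in\mathbb N$ satisfy, for all large $n$, $0<\epsilon<\theta_0<\tfrac12$, and, as $n\to\infty$, $$\beta=O(n^{-p/4}),\quad n^{1/2-p/2}=O(\beta),\quad n^{1-p}=O(\theta_0),\quad \ell=o(\sqrt n),\quad \ell\to\infty,$$ and suppose that for all large $n$ $$\beta\ \ge\ \frac{3\sqrt6}{C}\,\ell^{1/2-p/4}\,n^{-p/4}\sqrt{\log n}.$$ With $\tau=\tfrac12 C\beta n^{p/2}\ell^{p/2}$ we have $$\max\Bigl\{\Pr_{\mathbb Q}\bigl[\lambda_{\max}(\mathcal K)\ge\tfrac23\tau\bigr],\ \Pr_{\mathbb P}\bigl[\lambda_{\max}(\mathcal K)\le\tfrac43\tau\bigr]\Bigr\}\longrightarrow 0 .$$ Consequently, estimating $\lambda_{\max}(\mathcal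 K)$ solves hypergraph community detection: if, for all large $n$ and every hypergraph $Y$, the number $\hat\lambda_n(Y)$ satisfies $|\hat\lambda_n(Y)-\lambda_{\max}(\mathcal K)|\le\tfrac13\tau$ or $|\hat\lambda_n(Y)-\lambda_{\max}(\mathcal K)|\le\tfrac14|\lambda_{\max}(\mathcal K)|$, then the test $r$ with $r(Y)=1$ ("random") if $\hat\lambda_n(Y)\le\tau$ and $r(Y)=0$ ("planted") otherwise satisfies $\Pr_{\mathbb Q}[r(Y)=1]\to1$ and $\Pr_{\mathbb P}[r(Y)=0]\to1$. -/

import Mathlib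

open Filter Topology MeasureTheory ProbabilityTheory Asymptotics

namespace HSBM

noncomputable section

/-- The potential hyperedges: the `p`-element subsets of `[n]`. -/
abbrev Hyperedge (n p : ℕ) : Type := {S : Finset (Fin n) // S.card = p}

/-- A `p`-uniform hypergraph on `[n]`, given by its hyperedge indicators `Y_S`. -/
abbrev Hypergraph (n p : ℕ) : Type := Hyperedge n p → Bool

/-- `f(a₁, …, a_p) = ∑ᵢ ∏ⱼ (1_{aⱼ = i} - 1/k)`. -/
def f {k p : ℕ} (a : Fin p → Fin k) : ℝ :=
  ∑ i : Fin k, ∏ j : Fin p, ((if a j = i then (1 : ℝ) else 0) - 1 / (k : ℝ))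

/-- The labels `(x_{s₁}, …, x_{s_p})` of the vertices `s₁ < ⋯ < s_p` of `S`. -/
def restrictLabels {n k p : ℕ} (x : Fin n → Fin k) (S : Hyperedge n p) : Fin p → Fin k :=
  fun j => x (S.1.orderEmbOfFin S.2 j)

/-- `Bern(q)` on `Bool`. The parameter is clamped to `[0, 1]` only to make the definition total;
the clamping is inactive whenever `0 ≤ q ≤ 1`. -/
def bern (q : ℝ) : Measure Bool :=
  bernoulliMeasure true false (Set.projIcc (0 : ℝ) 1 zero_le_one q)

/-- The null law `ℚ`: all hyperedges are independent `Bern(θ₀)`. -/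
def nullLaw (n p : ℕ) (θ₀ : ℝ) : Measure (Hypergraph n p) :=
  Measure.pi fun _ => bern θ₀

/-- The planted law given the labels `x`: the hyperedges are independent
`Bern(θ₀ + ε f(x_S))`. -/
def condLaw (n p : ℕ) {k : ℕ} (θ₀ ε : ℝ) (x : Fin n → Fin k) : Measure (Hypergraph n p) :=
  Measure.pi fun S => bern (θ₀ + ε * f (restrictLabels x S))

/-- The planted law `ℙ`: the mixture of `condLaw` over uniform labels `x ∈ [k]ⁿ`. -/
def plantedLaw (n k p : ℕ) (θ₀ ε : ℝ) : Measure (Hypergraph n p) :=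
  ∑ x : Fin n → Fin k, ((k : ENNReal) ^ n)⁻¹ • condLaw n p θ₀ ε x

/-- The signal-to-noise ratio `β = ε / √(θ₀ (1 - θ₀))`. -/
def snr (θ₀ ε : ℝ) : ℝ := ε / √(θ₀ * (1 - θ₀))

/-- The normalized indicator `A_S = (Y_S - θ₀) / √(θ₀ (1 - θ₀))`. -/
def normalized {n p : ℕ} (θ₀ : ℝ) (Y : Hypergraph n p) (S : Hyperedge n p) : ℝ :=
  ((if Y S then (1 : ℝ) else 0) - θ₀) / √(θ₀ * (1 - θ₀))

/-- The symmetric `p`-tensor of the normalized indicators: its entry at `(μ₁, …, μ_p)` is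
`A_{{μ₁, …, μ_p}}` if the indices are distinct, and `0` otherwise. -/
def tensor {n p : ℕ} (θ₀ : ℝ) (Y : Hypergraph n p) (μ : Fin p → Fin n) : ℝ :=
  if h : Function.Injective μ then
    normalized θ₀ Y ⟨Finset.univ.map ⟨μ, h⟩, by simp⟩
  else 0

/-- The `ℓ`-tuples in `[n]` with no repeated entries. -/
abbrev Tuples (n ℓ : ℕ) : Type := Fin ℓ ↪ Fin n

/-- The positions, in increasing order, at which `S` and `V` disagree. -/
def disagreements {n ℓ : ℕ} (S V : Tuples n ℓ) : List (Fin ℓ) :=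
  (List.finRange ℓ).filter fun a => S a ≠ V a

/-- `S ⊖ V`: the disagreeing entries of `S`, in increasing index order, followed by those of
`V`, in the same order. -/
def ominus {n ℓ : ℕ} (S V : Tuples n ℓ) : List (Fin n) :=
  (disagreements S V).map S ++ (disagreements S V).map V

/-- The `ℓ`-th order bosonic Kikuchi matrix of a `p`-tensor `T`: its entry at `(S, V)` is
`T_{S ⊖ V}` if `S ⊖ V` is a `p`-tuple, and `0` otherwise. -/
def kikuchi {n p : ℕ} (ℓ : ℕ) (T : (Fin p → Fin n) → ℝ) :
    Matrix (Tuples n ℓ) (Tuples n ℓ) ℝ :=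
  fun S V =>
    if h : (ominus S V).length = p then T fun i => (ominus S V).get (i.cast h.symm) else 0

/-- The largest eigenvalue of a real symmetric matrix. -/
def lambdaMax {ι : Type*} [Fintype ι] [DecidableEq ι] (M : Matrix ι ι ℝ) : ℝ :=
  sSup (spectrum ℝ M)

/-- The largest eigenvalue of the `ℓ`-th order bosonic Kikuchi matrix of the hypergraph `Y`. -/
def kikuchiMax {n p : ℕ} (ℓ : ℕ) (θ₀ : ℝ) (Y : Hypergraph n p) : ℝ :=
  lambdaMax (kikuchi ℓ (tensor θ₀ Y))

/-- The threshold `τ = ½ C β n^{p/2} ℓ^{p/2}`. -/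
def threshold (C : ℝ) (n p ℓ : ℕ) (β : ℝ) : ℝ :=
  1 / 2 * C * β * (n : ℝ) ^ ((p : ℝ) / 2) * (ℓ : ℝ) ^ ((p : ℝ) / 2)

/-- The conditions on the parameters `θ₀ = θ₀(n)`, `ε = ε(n)`, `ℓ = ℓ(n)`:
for large `n` they define an HSBM, and
`n^{-p/4} ≳ β ≳ n^{1/2-p/2}`, `θ₀ ≳ n^{1-p}`, `ℓ = o(√n)`, `ℓ = ω(1)`. -/
structure ParamConds (p : ℕ) (θ₀ ε : ℕ → ℝ) (ℓ : ℕ → ℕ) : Prop where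
  theta_pos : ∀ᶠ n in atTop, 0 < θ₀ n
  theta_lt : ∀ᶠ n in atTop, θ₀ n < 1 / 2
  eps_pos : ∀ᶠ n in atTop, 0 < ε n
  eps_lt : ∀ᶠ n in atTop, ε n < θ₀ n
  snr_upper : (fun n => snr (θ₀ n) (ε n)) =O[atTop] fun n : ℕ => (n : ℝ) ^ (-(p : ℝ) / 4)
  snr_lower :
    (fun n : ℕ => (n : ℝ) ^ ((1 : ℝ) / 2 - (p : ℝ) / 2)) =O[atTop] fun n => snr (θ₀ n) (ε n)
  theta_lower : (fun n : ℕ => (n : ℝ) ^ (1 - (p : ℝ))) =O[atTop] θ₀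
  ell_small : (fun n => (ℓ n : ℝ)) =o[atTop] fun n : ℕ => √(n : ℝ)
  ell_large : Tendsto ℓ atTop atTop

/-- A family of tests `r(Y) ∈ {0, 1}` (with `true = 1`) solves hypergraph community detection if
`ℚ[r(Y) = 1] = 1 - o(1)` and `ℙ[r(Y) = 0] = 1 - o(1)`. -/
def SolvesDetection (k p : ℕ) (θ₀ ε : ℕ → ℝ) (r : ∀ n, Hypergraph n p → Bool) : Prop :=
  Tendsto (fun n => (nullLaw n p (θ₀ n)).real {Y | r n Y = true}) atTop (𝓝 1) ∧
  Tendsto (fun n => (plantedLaw n k p (θ₀ n) (ε n)).real {Y | r n Y = false}) atTop (𝓝 1)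

end

end HSBM

namespace HSBM
theorem tensor_congr {n p : ℕ} (θ₀ : ℝ) (Y : Hypergraph n p) (l l' : List (Fin n))
    (h : l.length = p) (h' : l'.length = p) (hp : l.Perm l') :
    tensor θ₀ Y (fun i => l.get (i.cast h.symm)) =
      tensor θ₀ Y (fun i => l'.get (i.cast h'.symm)) := by
  have inj : ∀ (l : List (Fin n)) (h : l.length = p),
      Function.Injective (fun i : Fin p => l.get (i.cast h.symm)) ↔ l.Nodup := by
    intro l h
    subst h
    exact List.nodup_iff_injective_get.symm
  unfold tensor
  by_cases hn : l.Nodup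
  · have hn' := hp.nodup_iff.1 hn
    rw [dif_pos ((inj l h).2 hn), dif_pos ((inj l' h').2 hn')]
    congr 1
    apply Subtype.ext
    ext a
    subst h
    have := hp.mem_iff (a := a)
    simp only [Finset.mem_map, Finset.mem_univ, true_and, Function.Embedding.coeFn_mk]
    rw [List.mem_iff_get, List.mem_iff_get] at this
    constructor
    · rintro ⟨i, hi⟩
      obtain ⟨j, hj⟩ := this.1 ⟨i, hi⟩
      exact ⟨j.cast h', hj⟩
    · rintro ⟨i, hi⟩
      obtain ⟨j, hj⟩ := this.2 ⟨i.cast h'.symm, hi⟩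
      exact ⟨j, hj⟩
  · rw [dif_neg (fun h0 => hn ((inj l h).1 h0)),
      dif_neg (fun h0 => hn (hp.nodup_iff.2 ((inj l' h').1 h0)))]

/-- The Kikuchi matrix of a hypergraph is symmetric. -/
theorem kikuchi_isHermitian {n p : ℕ} (ℓ : ℕ) (θ₀ : ℝ) (Y : Hypergraph n p) :
    (kikuchi ℓ (tensor θ₀ Y)).IsHermitian := by
  ext S V
  have hd : disagreements V S = disagreements S V := by
    simp only [disagreements, ne_comm]
  have hperm : (ominus V S).Perm (ominus S V) := by
    simp only [ominus, hd]
    exact List.perm_append_comm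
  simp only [Matrix.conjTranspose_apply, star_trivial, kikuchi]
  by_cases h : (ominus V S).length = p
  · rw [dif_pos h, dif_pos (hperm.length_eq ▸ h)]
    exact tensor_congr θ₀ Y _ _ h (hperm.length_eq ▸ h) hperm
  · rw [dif_neg h, dif_neg (fun h0 => h (hperm.length_eq.trans h0))]

/-- For a real symmetric matrix of positive size, `lambdaMax` is its largest eigenvalue. -/
theorem isGreatest_lambdaMax {ι : Type*} [Fintype ι] [DecidableEq ι] [Nonempty ι]
    {M : Matrix ι ι ℝ} (hM : M.IsHermitian) : IsGreatest (spectrum ℝ M) (lambdaMax M) := by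
  unfold lambdaMax
  rw [hM.spectrum_real_eq_range_eigenvalues]
  have hf : (Set.range hM.eigenvalues).Finite := Set.finite_range _
  exact ⟨(Set.range_nonempty _).csSup_mem hf, fun x hx => le_csSup hf.bddAbove hx⟩

end HSBM

namespace HSBM

/-! ### Weighted walks with independent random weights -/

section Walk

set_option linter.unusedSectionVars false

variable {ι E : Type*} [Fintype ι] [DecidableEq ι] [Fintype E] [DecidableEq E]

/-- The matrix whose entry at `(T, U)` is the weight of the label of the pair `(T, U)`. -/
def edgeMatrix (edge : ι → ι → Option E) (A : E → ℝ) : Matrix ι ι ℝ :=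
  fun T U => (edge T U).elim 0 A

/-- The exponential generating function of the moment bounds `L₀ ^ (i - 2)`, differentiated
`j` times, for one label; each use of the label contributes a factor `L / L₀`. -/
noncomputable def momentGen (L₀ L : ℝ) : ℕ → ℝ → ℝ
  | 0, _ => 1
  | 1, x => (Real.exp (L * x) - 1) / L₀
  | (j + 2), x => L₀ ^ j * Real.exp (L * x)

/-- The generating function bounding the weighted number of walks. -/
noncomputable def walkGen (d L₀ L : ℝ) (j : E → ℕ) (x : ℝ) : ℝ :=
  Real.exp (d / (L₀ * L) * (Real.exp (L * x) - L * x - 1)) * ∏ S, momentGen L₀ L (j S) x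

lemma momentGen_nonneg {L₀ L x : ℝ} (hL₀ : 0 < L₀) (hL : 0 ≤ L) (hx : 0 ≤ x) (j : ℕ) :
    0 ≤ momentGen L₀ L j x := by
  match j with
  | 0 => simp [momentGen]
  | 1 =>
    have : 1 ≤ Real.exp (L * x) := Real.one_le_exp (by positivity)
    exact div_nonneg (by linarith) hL₀.le
  | j + 2 => simp only [momentGen]; positivity

lemma walkGen_nonneg {d L₀ L x : ℝ} (hL₀ : 0 < L₀) (hL : 0 ≤ L) (hx : 0 ≤ x) (j : E → ℕ) :
    0 ≤ walkGen d L₀ L j x :=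
  mul_nonneg (Real.exp_pos _).le
    (Finset.prod_nonneg fun S _ => momentGen_nonneg hL₀ hL hx (j S))

lemma hasDerivAt_momentGen {L₀ h : ℝ} (hL₀ : 0 < L₀) (j : ℕ) (x : ℝ) :
    HasDerivAt (momentGen L₀ (h * L₀) j)
      (if j = 0 then 0 else h * momentGen L₀ (h * L₀) (j + 1) x) x := by
  have he : HasDerivAt (fun x => Real.exp (h * L₀ * x)) (Real.exp (h * L₀ * x) * (h * L₀)) x := by
    simpa using ((hasDerivAt_id x).const_mul (h * L₀)).exp
  match j with
  | 0 => exact hasDerivAt_const x 1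
  | 1 =>
    have := (he.sub_const 1).div_const L₀
    refine this.congr_deriv ?_
    simp only [momentGen, one_ne_zero, if_false, pow_zero, one_mul]
    field_simp
  | j + 2 =>
    have := he.const_mul (L₀ ^ j)
    refine this.congr_deriv ?_
    simp only [momentGen, Nat.add_eq_zero_iff, OfNat.ofNat_ne_zero, and_false, if_false]
    ring

lemma walkGen_add_single {d L₀ L : ℝ} (j : E → ℕ) (S : E) (x : ℝ) :
    walkGen d L₀ L (j + Pi.single S 1) x =
      Real.exp (d / (L₀ * L) * (Real.exp (L * x) - L * x - 1)) *
        ((∏ S' ∈ Finset.univ.erase S, momentGen L₀ L (j S') x) *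
          momentGen L₀ L (j S + 1) x) := by
  unfold walkGen
  rw [← Finset.prod_erase_mul _ _ (Finset.mem_univ S)]
  congr 2
  · refine Finset.prod_congr rfl fun S' hS' => ?_
    simp [Finset.ne_of_mem_erase hS']
  · simp

lemma walkGen_add_single_of_zero {d L₀ L : ℝ} (j : E → ℕ) (S : E) (hS : j S = 0) (x : ℝ) :
    walkGen d L₀ L (j + Pi.single S 1) x = momentGen L₀ L 1 x * walkGen d L₀ L j x := by
  rw [walkGen_add_single, walkGen, ← Finset.prod_erase_mul _ _ (Finset.mem_univ S), hS]
  simp [momentGen]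
  ring

lemma hasDerivAt_walkGen {d L₀ h : ℝ} (hL₀ : 0 < L₀) (hh : 0 < h) (j : E → ℕ) (x : ℝ) :
    HasDerivAt (walkGen d L₀ (h * L₀) j)
      (d * momentGen L₀ (h * L₀) 1 x * walkGen d L₀ (h * L₀) j x +
        ∑ S with j S ≠ 0, h * walkGen d L₀ (h * L₀) (j + Pi.single S 1) x) x := by
  have he : HasDerivAt (fun x => Real.exp (h * L₀ * x)) (Real.exp (h * L₀ * x) * (h * L₀)) x := by
    simpa using ((hasDerivAt_id x).const_mul (h * L₀)).exp
  have hl : HasDerivAt (fun x => h * L₀ * x) (h * L₀) x := by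
    simpa using (hasDerivAt_id x).const_mul (h * L₀)
  have h1 := (((he.sub hl).sub_const 1).const_mul (d / (L₀ * (h * L₀)))).exp
  have h2 := HasDerivAt.fun_finsetProd (u := Finset.univ) (x := x)
    fun S _ => hasDerivAt_momentGen (h := h) hL₀ (j S) x
  refine (h1.mul h2).congr_deriv (Eq.symm ?_)
  congr 1
  · simp only [walkGen, momentGen, Pi.sub_apply]
    field_simp
  · rw [Finset.mul_sum, Finset.sum_filter]
    refine Finset.sum_congr rfl fun S _ => ?_
    by_cases hS : j S = 0
    · simp [hS]
    · rw [if_pos hS, if_neg hS, walkGen_add_single]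
      simp only [smul_eq_mul, Pi.sub_apply]
      ring

/-- The sum of the generating functions over the neighbours of `T` is at most the derivative. -/
lemma sum_walkGen_le {d L₀ h x : ℝ} (hL₀ : 0 < L₀) (hh : 0 < h) (hx : 0 ≤ x)
    (edge : ι → ι → Option E) (T : ι)
    (hfib : ∀ S, ((Finset.univ.filter fun U => edge T U = some S).card : ℝ) ≤ h)
    (hdeg : ((Finset.univ.filter fun U => (edge T U).isSome).card : ℝ) ≤ d) (j : E → ℕ) :
    ∑ U, (edge T U).elim 0 (fun S => walkGen d L₀ (h * L₀) (j + Pi.single S 1) x) ≤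
      d * momentGen L₀ (h * L₀) 1 x * walkGen d L₀ (h * L₀) j x +
        ∑ S with j S ≠ 0, h * walkGen d L₀ (h * L₀) (j + Pi.single S 1) x := by
  have hL : 0 ≤ h * L₀ := by positivity
  set W : E → ℝ := fun S => walkGen d L₀ (h * L₀) (j + Pi.single S 1) x with hW
  have hW0 : ∀ S, 0 ≤ W S := fun S => walkGen_nonneg hL₀ hL hx _
  have hB := walkGen_nonneg (d := d) hL₀ hL hx j
  have hM := momentGen_nonneg hL₀ hL hx 1
  have hsplit : ∀ U, (edge T U).elim 0 W ≤
      (if (edge T U).isSome then momentGen L₀ (h * L₀) 1 x * walkGen d L₀ (h * L₀) j x else 0) +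
        ∑ S with j S ≠ 0, if edge T U = some S then W S else 0 := by
    intro U
    cases hU : edge T U with
    | none => simp
    | some S =>
      simp only [Option.elim_some, Option.isSome_some, if_true, Option.some.injEq]
      by_cases hS : j S = 0
      · have : W S = _ := walkGen_add_single_of_zero (d := d) (L₀ := L₀) (L := h * L₀) j S hS x
        rw [this]
        exact le_add_of_nonneg_right (Finset.sum_nonneg fun S' _ => by
          split_ifs
          exacts [hW0 _, le_rfl])
      · rw [Finset.sum_ite_eq]
        simp [hS]
        positivity
  calc ∑ U, (edge T U).elim 0 W
      ≤ ∑ U, ((if (edge T U).isSome then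
          momentGen L₀ (h * L₀) 1 x * walkGen d L₀ (h * L₀) j x else 0) +
        ∑ S with j S ≠ 0, if edge T U = some S then W S else 0) :=
        Finset.sum_le_sum fun U _ => hsplit U
    _ = ((Finset.univ.filter fun U => (edge T U).isSome).card : ℝ) *
          (momentGen L₀ (h * L₀) 1 x * walkGen d L₀ (h * L₀) j x) +
        ∑ S with j S ≠ 0,
          ((Finset.univ.filter fun U => edge T U = some S).card : ℝ) * W S := by
        rw [Finset.sum_add_distrib, Finset.sum_comm]
        congr 1
        · rw [← Finset.sum_filter]; simp
        · refine Finset.sum_congr rfl fun S _ => ?_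
          rw [← Finset.sum_filter]; simp
    _ ≤ _ := by
        rw [mul_assoc]
        refine add_le_add (mul_le_mul_of_nonneg_right hdeg (by positivity))
          (Finset.sum_le_sum fun S _ => mul_le_mul_of_nonneg_right (hfib S) (hW0 S))

variable {Ω : Type*} [MeasurableSpace Ω] [Finite Ω] [MeasurableSingletonClass Ω]

/-- The total absolute mixed moment of the walks of length `r` from `T`. -/
noncomputable def walkMoment (μ : Measure Ω) (edge : ι → ι → Option E) (A : Ω → E → ℝ)
    (r : ℕ) (T : ι) (j : E → ℕ) : ℝ :=
  ∑ U, |∫ ω, (∏ S, A ω S ^ j S) * ((edgeMatrix edge (A ω)) ^ r) T U ∂μ|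

lemma walkMoment_succ_le (μ : Measure Ω) [IsFiniteMeasure μ] (edge : ι → ι → Option E)
    (A : Ω → E → ℝ) (r : ℕ) (T : ι) (j : E → ℕ) :
    walkMoment μ edge A (r + 1) T j ≤
      ∑ U, (edge T U).elim 0 (fun S => walkMoment μ edge A r U (j + Pi.single S 1)) := by
  have hstep : ∀ V, (∫ ω, (∏ S, A ω S ^ j S) * ((edgeMatrix edge (A ω)) ^ (r + 1)) T V ∂μ) =
      ∑ U, (edge T U).elim 0 fun S =>
        ∫ ω, (∏ S', A ω S' ^ (j + Pi.single S 1 : E → ℕ) S') * ((edgeMatrix edge (A ω)) ^ r) U V ∂μ := by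
    intro V
    have : ∀ ω, (∏ S, A ω S ^ j S) * ((edgeMatrix edge (A ω)) ^ (r + 1)) T V =
        ∑ U, (edge T U).elim 0 fun S =>
          (∏ S', A ω S' ^ (j + Pi.single S 1 : E → ℕ) S') * ((edgeMatrix edge (A ω)) ^ r) U V := by
      intro ω
      rw [pow_succ', Matrix.mul_apply, Finset.mul_sum]
      refine Finset.sum_congr rfl fun U _ => ?_
      cases hU : edge T U with
      | none => simp [edgeMatrix, hU]
      | some S =>
        simp only [edgeMatrix, hU, Option.elim_some, Pi.add_apply, pow_add,
          Finset.prod_mul_distrib]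
        have : ∏ S', A ω S' ^ (Pi.single S 1 : E → ℕ) S' = A ω S := by
          rw [Finset.prod_eq_single S]
          · simp
          · intro b _ hb; simp [hb]
          · simp
        rw [this]
        ring
    simp_rw [this]
    rw [integral_finsetSum _ fun U _ => Integrable.of_finite]
    refine Finset.sum_congr rfl fun U _ => ?_
    cases edge T U <;> simp
  unfold walkMoment
  calc _ ≤ ∑ V, ∑ U, (edge T U).elim 0 fun S =>
        |∫ ω, (∏ S', A ω S' ^ (j + Pi.single S 1 : E → ℕ) S') *
          ((edgeMatrix edge (A ω)) ^ r) U V ∂μ| := by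
        refine Finset.sum_le_sum fun V _ => ?_
        rw [hstep]
        refine (Finset.abs_sum_le_sum_abs _ _).trans (Finset.sum_le_sum fun U _ => ?_)
        cases edge T U <;> simp
    _ = _ := by
        rw [Finset.sum_comm]
        refine Finset.sum_congr rfl fun U _ => ?_
        cases edge T U <;> simp

/-- The exponential sums of the walk moments are bounded by the generating function. -/
lemma sum_walkMoment_le (μ : Measure Ω) [IsFiniteMeasure μ] (edge : ι → ι → Option E)
    (A : Ω → E → ℝ) {d L₀ h : ℝ} (hL₀ : 0 < L₀) (hh : 0 < h)
    (hfib : ∀ T S, ((Finset.univ.filter fun U => edge T U = some S).card : ℝ) ≤ h)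
    (hdeg : ∀ T, ((Finset.univ.filter fun U => (edge T U).isSome).card : ℝ) ≤ d)
    (hmom : ∀ j : E → ℕ, |∫ ω, ∏ S, A ω S ^ j S ∂μ| ≤ walkGen d L₀ (h * L₀) j 0)
    (m : ℕ) : ∀ (T : ι) (j : E → ℕ) (x : ℝ), 0 ≤ x →
      ∑ r ∈ Finset.range m, x ^ r / r.factorial * walkMoment μ edge A r T j ≤
        walkGen d L₀ (h * L₀) j x := by
  induction m with
  | zero =>
    intro T j x hx
    simpa using walkGen_nonneg hL₀ (by positivity) hx j
  | succ m ih =>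
    intro T j x hx
    have hderiv : ∀ y, HasDerivAt
        (fun y : ℝ => ∑ r ∈ Finset.range (m + 1),
          y ^ r / r.factorial * walkMoment μ edge A r T j)
        (∑ r ∈ Finset.range m, y ^ r / r.factorial * walkMoment μ edge A (r + 1) T j) y := by
      intro y
      have h0 : ∀ r ∈ Finset.range (m + 1), HasDerivAt
          (fun y : ℝ => y ^ r / r.factorial * walkMoment μ edge A r T j)
          (r * y ^ (r - 1) / r.factorial * walkMoment μ edge A r T j) y := fun r _ =>
        ((hasDerivAt_pow r y).div_const _).mul_const _
      have h1 := HasDerivAt.fun_sum h0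
      refine h1.congr_deriv (Eq.symm ?_)
      rw [Finset.sum_range_succ']
      simp only [CharP.cast_eq_zero, zero_mul, zero_div, add_zero]
      refine Finset.sum_congr rfl fun r _ => ?_
      rw [Nat.factorial_succ]
      push_cast
      field_simp
    have hmono : MonotoneOn (fun y : ℝ => walkGen d L₀ (h * L₀) j y -
        ∑ r ∈ Finset.range (m + 1), y ^ r / r.factorial * walkMoment μ edge A r T j)
        (Set.Ici 0) := by
      refine monotoneOn_of_deriv_nonneg (convex_Ici 0) ?_ ?_ ?_
      · exact fun y _ => ((hasDerivAt_walkGen hL₀ hh j y).sub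
          (hderiv y)).continuousAt.continuousWithinAt
      · exact fun y _ => ((hasDerivAt_walkGen hL₀ hh j y).sub
          (hderiv y)).differentiableAt.differentiableWithinAt
      · intro y hy
        have hy0 : 0 ≤ y := interior_subset hy
        have hd := ((hasDerivAt_walkGen (d := d) hL₀ hh j y).sub (hderiv y)).deriv
        refine le_of_le_of_eq (sub_nonneg.2 ?_) hd.symm
        refine le_trans ?_ (sum_walkGen_le hL₀ hh hy0 edge T (hfib T) (hdeg T) j)
        calc _ ≤ ∑ r ∈ Finset.range m, y ^ r / r.factorial *
              ∑ U, (edge T U).elim 0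
                (fun S => walkMoment μ edge A r U (j + Pi.single S 1)) := by
              refine Finset.sum_le_sum fun r _ => ?_
              exact mul_le_mul_of_nonneg_left (walkMoment_succ_le μ edge A r T j) (by positivity)
          _ = ∑ U, (edge T U).elim 0 (fun S => ∑ r ∈ Finset.range m, y ^ r / r.factorial *
                walkMoment μ edge A r U (j + Pi.single S 1)) := by
              simp_rw [Finset.mul_sum]
              rw [Finset.sum_comm]
              refine Finset.sum_congr rfl fun U _ => ?_
              cases edge T U <;> simp
          _ ≤ _ := by
              refine Finset.sum_le_sum fun U _ => ?_
              cases edge T U with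
              | none => simp
              | some S => exact ih U _ y hy0
    have h0 := hmono (Set.mem_Ici.2 le_rfl) (Set.mem_Ici.2 hx) hx
    have hz : ∑ r ∈ Finset.range (m + 1), (0 : ℝ) ^ r / r.factorial *
        walkMoment μ edge A r T j = |∫ ω, ∏ S, A ω S ^ j S ∂μ| := by
      rw [Finset.sum_range_succ', Finset.sum_eq_zero fun r _ => by simp]
      simp only [pow_zero, Nat.factorial_zero, Nat.cast_one, div_one, one_mul, zero_add,
        walkMoment]
      rw [Finset.sum_eq_single T]
      · simp
      · intro U _ hU
        simp [Matrix.one_apply_ne hU.symm]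
      · simp
    simp only [hz] at h0
    have := hmom j
    linarith

lemma trace_pow_eq_sum_eigenvalues {M : Matrix ι ι ℝ} (hM : M.IsHermitian) (r : ℕ) :
    (M ^ r).trace = ∑ i, hM.eigenvalues i ^ r := by
  conv_lhs => rw [hM.spectral_theorem, ← map_pow, Unitary.conjStarAlgAut_apply,
    Matrix.trace_mul_cycle, Matrix.diagonal_pow]
  simp [Matrix.trace]

/-- Exponential moment of the largest eigenvalue of a random symmetric matrix of labelled
independent weights. -/
lemma integral_exp_lambdaMax_le (μ : Measure Ω) [IsFiniteMeasure μ] [Nonempty ι]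
    (edge : ι → ι → Option E)
    (A : Ω → E → ℝ) {d L₀ h : ℝ} (hL₀ : 0 < L₀) (hh : 0 < h)
    (hsymm : ∀ ω, (edgeMatrix edge (A ω)).IsHermitian)
    (hfib : ∀ T S, ((Finset.univ.filter fun U => edge T U = some S).card : ℝ) ≤ h)
    (hdeg : ∀ T, ((Finset.univ.filter fun U => (edge T U).isSome).card : ℝ) ≤ d)
    (hmom : ∀ j : E → ℕ, |∫ ω, ∏ S, A ω S ^ j S ∂μ| ≤ walkGen d L₀ (h * L₀) j 0)
    {x : ℝ} (hx : 0 ≤ x) :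
    ∫ ω, Real.exp (x * lambdaMax (edgeMatrix edge (A ω))) ∂μ ≤
      Fintype.card ι *
        Real.exp (d / (L₀ * (h * L₀)) * (Real.exp (h * L₀ * x) - h * L₀ * x - 1)) := by
  have hpart : ∀ m : ℕ, ∫ ω, ∑ r ∈ Finset.range m,
      x ^ r / r.factorial * ((edgeMatrix edge (A ω)) ^ r).trace ∂μ ≤
      Fintype.card ι *
        Real.exp (d / (L₀ * (h * L₀)) * (Real.exp (h * L₀ * x) - h * L₀ * x - 1)) := by
    intro m
    have hw : walkGen d L₀ (h * L₀) (0 : E → ℕ) x =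
        Real.exp (d / (L₀ * (h * L₀)) * (Real.exp (h * L₀ * x) - h * L₀ * x - 1)) := by
      simp [walkGen, momentGen]
    calc _ = ∑ r ∈ Finset.range m, x ^ r / r.factorial *
          ∑ T, ∫ ω, ((edgeMatrix edge (A ω)) ^ r) T T ∂μ := by
          rw [integral_finsetSum _ fun r _ => Integrable.of_finite]
          refine Finset.sum_congr rfl fun r _ => ?_
          rw [integral_const_mul]
          simp only [Matrix.trace, Matrix.diag_apply]
          rw [integral_finsetSum _ fun r _ => Integrable.of_finite]
      _ ≤ ∑ r ∈ Finset.range m, x ^ r / r.factorial *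
          ∑ T, walkMoment μ edge A r T 0 := by
          refine Finset.sum_le_sum fun r _ => mul_le_mul_of_nonneg_left
            (Finset.sum_le_sum fun T _ => ?_) (by positivity)
          unfold walkMoment
          refine le_trans ?_ (Finset.single_le_sum (fun U _ => abs_nonneg _)
            (Finset.mem_univ T))
          simpa using le_abs_self _
      _ = ∑ T, ∑ r ∈ Finset.range m, x ^ r / r.factorial * walkMoment μ edge A r T 0 := by
          simp_rw [Finset.mul_sum]
          rw [Finset.sum_comm]
      _ ≤ ∑ T : ι, walkGen d L₀ (h * L₀) (0 : E → ℕ) x :=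
          Finset.sum_le_sum fun T _ =>
            sum_walkMoment_le μ edge A hL₀ hh hfib hdeg hmom m T 0 x hx
      _ = _ := by simp [hw]
  have hlim : Tendsto (fun m : ℕ => ∫ ω, ∑ r ∈ Finset.range m,
      x ^ r / r.factorial * ((edgeMatrix edge (A ω)) ^ r).trace ∂μ) atTop
      (𝓝 (∫ ω, ∑ i, Real.exp (x * (hsymm ω).eigenvalues i) ∂μ)) := by
    cases nonempty_fintype Ω
    simp_rw [integral_fintype Integrable.of_finite]
    refine tendsto_finsetSum _ fun ω _ => Tendsto.const_smul ?_ _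
    have heq : ∀ m : ℕ, ∑ r ∈ Finset.range m,
        x ^ r / r.factorial * ((edgeMatrix edge (A ω)) ^ r).trace =
        ∑ i, ∑ r ∈ Finset.range m, (x * (hsymm ω).eigenvalues i) ^ r / r.factorial := by
      intro m
      rw [Finset.sum_comm]
      refine Finset.sum_congr rfl fun r _ => ?_
      rw [trace_pow_eq_sum_eigenvalues (hsymm ω), Finset.mul_sum]
      refine Finset.sum_congr rfl fun i _ => ?_
      rw [mul_pow]; ring
    simp_rw [heq]
    refine tendsto_finsetSum _ fun i _ => ?_
    have := (NormedSpace.expSeries_div_hasSum_exp (𝔸 := ℝ) (x * (hsymm ω).eigenvalues i))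
    rw [← Real.exp_eq_exp_ℝ] at this
    exact this.tendsto_sum_nat
  refine le_trans ?_ (le_of_tendsto' hlim hpart)
  refine integral_mono Integrable.of_finite Integrable.of_finite fun ω => ?_
  have hmem := (isGreatest_lambdaMax (hsymm ω)).1
  rw [(hsymm ω).spectrum_real_eq_range_eigenvalues] at hmem
  obtain ⟨i, hi⟩ := hmem
  simp only [← hi]
  exact Finset.single_le_sum (f := fun i => Real.exp (x * (hsymm ω).eigenvalues i))
    (fun i _ => (Real.exp_pos _).le) (Finset.mem_univ i)

/-- Rayleigh bound for `lambdaMax`. -/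
lemma dotProduct_mulVec_le_lambdaMax [Nonempty ι] {M : Matrix ι ι ℝ} (hM : M.IsHermitian)
    (v : ι → ℝ) : v ⬝ᵥ M.mulVec v ≤ lambdaMax M * (v ⬝ᵥ v) := by
  have hps : (algebraMap ℝ (Matrix ι ι ℝ) (lambdaMax M) - M).PosSemidef := by
    rw [Matrix.posSemidef_iff_isHermitian_and_spectrum_nonneg]
    refine ⟨?_, ?_⟩
    · refine Matrix.IsHermitian.sub ?_ hM
      rw [Matrix.algebraMap_eq_diagonal]
      exact Matrix.isHermitian_diagonal _
    · rw [← spectrum.singleton_sub_eq]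
      rintro _ ⟨a, ha, b, hb, rfl⟩
      rw [Set.mem_singleton_iff] at ha
      subst ha
      exact sub_nonneg.2 ((isGreatest_lambdaMax hM).2 hb)
  have := hps.dotProduct_mulVec_nonneg v
  simp only [star_trivial, Matrix.sub_mulVec, dotProduct_sub] at this
  rw [Algebra.algebraMap_eq_smul_one, Matrix.smul_mulVec, Matrix.one_mulVec, dotProduct_smul, smul_eq_mul] at this
  linarith

end Walk

end HSBM

namespace HSBM

/-! ### The hyperedge labels of the Kikuchi matrix -/

section Labels

variable {n ℓ p : ℕ}

/-- The positions at which two tuples disagree. -/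
def diffSet (T U : Tuples n ℓ) : Finset (Fin ℓ) := Finset.univ.filter fun a => T a ≠ U a

lemma mem_diffSet {T U : Tuples n ℓ} {a : Fin ℓ} : a ∈ diffSet T U ↔ T a ≠ U a := by
  simp [diffSet]

lemma disagreements_nodup (T U : Tuples n ℓ) : (disagreements T U).Nodup :=
  (List.nodup_finRange ℓ).filter _

lemma disagreements_toFinset (T U : Tuples n ℓ) :
    (disagreements T U).toFinset = diffSet T U := by
  ext a
  simp [disagreements, diffSet]

lemma length_ominus (T U : Tuples n ℓ) : (ominus T U).length = 2 * (diffSet T U).card := by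
  rw [← disagreements_toFinset, List.toFinset_card_of_nodup (disagreements_nodup T U)]
  simp [ominus]
  ring

lemma mem_ominus {T U : Tuples n ℓ} {s : Fin n} :
    s ∈ ominus T U ↔ ∃ a, T a ≠ U a ∧ (s = T a ∨ s = U a) := by
  simp only [ominus, disagreements, List.mem_append, List.mem_map, List.mem_filter,
    List.mem_finRange, true_and, decide_eq_true_eq]
  constructor
  · rintro (⟨a, h, rfl⟩ | ⟨a, h, rfl⟩)
    exacts [⟨a, h, Or.inl rfl⟩, ⟨a, h, Or.inr rfl⟩]
  · rintro ⟨a, h, rfl | rfl⟩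
    exacts [Or.inl ⟨a, h, rfl⟩, Or.inr ⟨a, h, rfl⟩]

lemma nodup_ominus_iff {T U : Tuples n ℓ} :
    (ominus T U).Nodup ↔ ∀ a, T a ≠ U a → ∀ b, U a ≠ T b := by
  rw [ominus, List.nodup_append]
  have h1 := (disagreements_nodup T U).map T.injective
  have h2 := (disagreements_nodup T U).map U.injective
  rw [and_iff_right h1, and_iff_right h2]
  simp only [true_and, disagreements, List.mem_map, List.mem_filter, List.mem_finRange,
    decide_eq_true_eq]
  constructor
  · intro h a ha b hab
    by_cases hb : T b = U b
    · exact ha (by rw [hab, U.injective (hab.trans hb)])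
    · exact h (T b) ⟨b, hb, rfl⟩ (U a) ⟨a, ha, rfl⟩ hab.symm
  · rintro h _ ⟨b, _, rfl⟩ _ ⟨a, ha, rfl⟩ hab
    exact h a ha b hab.symm

/-- The hyperedge `S ⊖ V` of two tuples, if it has `p` distinct entries. -/
def edgeOf (p : ℕ) (T U : Tuples n ℓ) : Option (Hyperedge n p) :=
  if h : (ominus T U).length = p ∧ (ominus T U).Nodup then
    some ⟨(ominus T U).toFinset, by rw [List.toFinset_card_of_nodup h.2, h.1]⟩
  else none

lemma edgeOf_eq_some {T U : Tuples n ℓ} {S : Hyperedge n p} :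
    edgeOf p T U = some S ↔ (ominus T U).length = p ∧ (ominus T U).Nodup ∧
      (ominus T U).toFinset = S.1 := by
  unfold edgeOf
  split_ifs with h
  · simp [h.1, h.2, Subtype.ext_iff]
  · simp only [false_iff]
    tauto

lemma edgeOf_isSome {T U : Tuples n ℓ} :
    (edgeOf p T U).isSome ↔ 2 * (diffSet T U).card = p ∧ ∀ a, T a ≠ U a → ∀ b, U a ≠ T b := by
  rw [← length_ominus, ← nodup_ominus_iff]
  unfold edgeOf
  split_ifs with h <;> simpa using h

lemma edgeOf_eq_some_iff {T U : Tuples n ℓ} {S : Hyperedge n p} :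
    edgeOf p T U = some S ↔ 2 * (diffSet T U).card = p ∧ (∀ a, T a ≠ U a → ∀ b, U a ≠ T b) ∧
      ∀ s, s ∈ S.1 ↔ ∃ a, T a ≠ U a ∧ (s = T a ∨ s = U a) := by
  rw [edgeOf_eq_some, length_ominus, nodup_ominus_iff, Finset.ext_iff]
  simp only [List.mem_toFinset, mem_ominus, iff_comm]

lemma kikuchi_tensor_eq (θ₀ : ℝ) (Y : Hypergraph n p) :
    kikuchi ℓ (tensor θ₀ Y) = edgeMatrix (edgeOf p) (normalized θ₀ Y) := by
  ext T U
  unfold kikuchi edgeMatrix edgeOf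
  by_cases h : (ominus T U).length = p
  · have inj : Function.Injective (fun i : Fin p => (ominus T U).get (i.cast h.symm)) ↔
        (ominus T U).Nodup := by
      subst h
      exact List.nodup_iff_injective_get.symm
    rw [dif_pos h]
    unfold tensor
    by_cases hn : (ominus T U).Nodup
    · rw [dif_pos (inj.2 hn), dif_pos ⟨h, hn⟩, Option.elim_some]
      congr 1
      apply Subtype.ext
      ext a
      simp only [Finset.mem_map, Finset.mem_univ, true_and, Function.Embedding.coeFn_mk,
        List.mem_toFinset]
      rw [List.mem_iff_get]
      exact ⟨fun ⟨i, hi⟩ => ⟨_, hi⟩, fun ⟨i, hi⟩ => ⟨i.cast h, hi⟩⟩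
    · rw [dif_neg (fun h0 => hn (inj.1 h0)), dif_neg (fun h0 => hn h0.2), Option.elim_none]
  · rw [dif_neg h, dif_neg (fun h0 => h h0.1), Option.elim_none]

lemma card_fiber_edgeOf_le {q : ℕ} (T : Tuples n ℓ) (S : Hyperedge n (2 * q)) :
    (Finset.univ.filter fun U => edgeOf (2 * q) T U = some S).card ≤ q.factorial := by
  rcases (Finset.univ.filter fun U => edgeOf (2 * q) T U = some S).eq_empty_or_nonempty with
    h0 | ⟨U₀, hU₀⟩
  · simp [h0]
  have hdiff : ∀ U, edgeOf (2 * q) T U = some S →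
      diffSet T U = Finset.univ.filter fun a => T a ∈ S.1 := by
    intro U hU
    obtain ⟨_, h2, h3⟩ := edgeOf_eq_some_iff.1 hU
    ext a
    rw [mem_diffSet, Finset.mem_filter, h3]
    constructor
    · exact fun ha => ⟨Finset.mem_univ _, a, ha, Or.inl rfl⟩
    · rintro ⟨_, b, hb, hab | hab⟩
      · rwa [T.injective hab]
      · exact absurd hab.symm (h2 b hb a)
  set D : Finset (Fin ℓ) := Finset.univ.filter fun a => T a ∈ S.1 with hD
  have hDcard : D.card = q := by
    have hU := (Finset.mem_filter.1 hU₀).2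
    have := (edgeOf_eq_some_iff.1 hU).1
    rw [hdiff U₀ hU] at this
    omega
  set R : Finset (Fin n) := S.1 \ D.map T with hR
  have hRcard : R.card = q := by
    rw [hR, Finset.card_sdiff_of_subset, S.2, Finset.card_map, hDcard]
    · omega
    · intro s hs
      obtain ⟨a, ha, rfl⟩ := Finset.mem_map.1 hs
      exact (Finset.mem_filter.1 ha).2
  have hmem : ∀ U, edgeOf (2 * q) T U = some S → ∀ a ∈ D, U a ∈ R := by
    intro U hU a ha
    obtain ⟨_, h2, h3⟩ := edgeOf_eq_some_iff.1 hU
    rw [← hdiff U hU, mem_diffSet] at ha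
    rw [hR, Finset.mem_sdiff]
    refine ⟨(h3 _).2 ⟨a, ha, Or.inr rfl⟩, fun hm => ?_⟩
    obtain ⟨b, _, hb⟩ := Finset.mem_map.1 hm
    exact h2 a ha b hb.symm
  have hle := Fintype.card_le_of_injective
    (fun U : {U // edgeOf (2 * q) T U = some S} =>
      (⟨fun a : D => (⟨U.1 a, hmem U.1 U.2 a a.2⟩ : R), fun a b hab =>
        Subtype.ext (U.1.injective (by simpa using hab))⟩ : D ↪ R)) (by
      intro U V hUV
      apply Subtype.ext
      ext1 a
      by_cases ha : a ∈ D
      · have := DFunLike.congr_fun hUV ⟨a, ha⟩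
        exact congrArg Subtype.val this
      · have hU : T a = U.1 a := by
          by_contra h
          exact ha (hdiff U.1 U.2 ▸ mem_diffSet.2 h)
        have hV : T a = V.1 a := by
          by_contra h
          exact ha (hdiff V.1 V.2 ▸ mem_diffSet.2 h)
        rw [← hU, ← hV])
  rw [Fintype.card_subtype, Fintype.card_embedding_eq, Fintype.card_coe, Fintype.card_coe, hDcard,
    hRcard, Nat.descFactorial_self] at hle
  exact hle

/-- The tuple obtained from `T` by replacing its entries at the positions in `D`. -/
def replaceTuple (T : Tuples n ℓ) (D : Finset (Fin ℓ))
    (e : D ↪ {s // s ∉ Finset.univ.map T}) : Tuples n ℓ :=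
  ⟨fun a => if h : a ∈ D then (e ⟨a, h⟩).1 else T a, by
    have hne : ∀ (a : D) (b : Fin ℓ), (e a).1 ≠ T b := fun a b h =>
      (e a).2 (h ▸ Finset.mem_map_of_mem T (Finset.mem_univ b))
    intro a b hab
    by_cases ha : a ∈ D <;> by_cases hb : b ∈ D <;> simp only [ha, hb, dif_pos, dif_neg,
      not_false_iff] at hab
    · simpa using e.injective (Subtype.ext hab)
    · exact absurd hab (hne _ _)
    · exact absurd hab.symm (hne _ _)
    · exact T.injective hab⟩

lemma replaceTuple_of_mem {T : Tuples n ℓ} {D : Finset (Fin ℓ)}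
    (e : D ↪ {s // s ∉ Finset.univ.map T}) {a : Fin ℓ} (h : a ∈ D) :
    replaceTuple T D e a = (e ⟨a, h⟩).1 := dif_pos h

lemma replaceTuple_of_notMem {T : Tuples n ℓ} {D : Finset (Fin ℓ)}
    (e : D ↪ {s // s ∉ Finset.univ.map T}) {a : Fin ℓ} (h : a ∉ D) :
    replaceTuple T D e a = T a := dif_neg h

/-- The tuples that differ from `T` exactly on `D`, with new entries outside of `T`. -/
def replaceEquiv (T : Tuples n ℓ) (D : Finset (Fin ℓ)) :
    {U : Tuples n ℓ // diffSet T U = D ∧ ∀ a, T a ≠ U a → ∀ b, U a ≠ T b} ≃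
      (D ↪ {s // s ∉ Finset.univ.map T}) where
  toFun U := ⟨fun a => ⟨U.1 a, fun hm => by
      obtain ⟨b, _, hb⟩ := Finset.mem_map.1 hm
      exact U.2.2 a (mem_diffSet.1 (U.2.1.symm.subset a.2)) b hb.symm⟩, fun a b hab =>
        Subtype.ext (U.1.injective (by simpa using hab))⟩
  invFun e := ⟨replaceTuple T D e, by
      have hne : ∀ (a : D) (b : Fin ℓ), (e a).1 ≠ T b := fun a b h =>
        (e a).2 (h ▸ Finset.mem_map_of_mem T (Finset.mem_univ b))
      refine ⟨?_, ?_⟩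
      · ext a
        rw [mem_diffSet]
        by_cases ha : a ∈ D
        · rw [replaceTuple_of_mem e ha]
          simpa [ha] using (hne ⟨a, ha⟩ a).symm
        · rw [replaceTuple_of_notMem e ha]
          simp [ha]
      · intro a ha b
        by_cases haD : a ∈ D
        · rw [replaceTuple_of_mem e haD]
          exact hne ⟨a, haD⟩ b
        · exact absurd (replaceTuple_of_notMem e haD).symm ha⟩
  left_inv U := by
    apply Subtype.ext
    ext1 a
    by_cases ha : a ∈ D
    · exact replaceTuple_of_mem _ ha
    · have : T a = U.1 a := by
        by_contra h
        exact ha (U.2.1 ▸ mem_diffSet.2 h)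
      exact (replaceTuple_of_notMem _ ha).trans this
  right_inv e := by
    ext1 a
    exact Subtype.ext (replaceTuple_of_mem e a.2)

lemma card_edgeOf_isSome {q : ℕ} (T : Tuples n ℓ) :
    (Finset.univ.filter fun U => (edgeOf (2 * q) T U).isSome).card =
      ℓ.choose q * (n - ℓ).descFactorial q := by
  classical
  rw [Finset.card_eq_sum_card_fiberwise (f := diffSet T)
    (t := Finset.powersetCard q Finset.univ)]
  · have : ∀ D ∈ Finset.powersetCard q (Finset.univ : Finset (Fin ℓ)),
        ((Finset.univ.filter fun U => (edgeOf (2 * q) T U).isSome).filter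
          fun U => diffSet T U = D).card = (n - ℓ).descFactorial q := by
      intro D hD
      have hDc := (Finset.mem_powersetCard.1 hD).2
      have h1 := Fintype.card_congr (replaceEquiv T D)
      rw [Fintype.card_embedding_eq, Fintype.card_coe, hDc, Fintype.card_subtype_compl,
        Fintype.card_coe, Finset.card_map, Finset.card_univ, Fintype.card_fin,
        Fintype.card_fin, Fintype.card_subtype] at h1
      rw [← h1, Finset.filter_filter]
      congr 1
      ext U
      simp only [Finset.mem_filter, Finset.mem_univ, true_and, edgeOf_isSome]
      constructor
      · rintro ⟨⟨_, h⟩, h'⟩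
        exact ⟨h', h⟩
      · rintro ⟨h', h⟩
        exact ⟨⟨by rw [h', hDc], h⟩, h'⟩
    rw [Finset.sum_congr rfl this, Finset.sum_const, Finset.card_powersetCard, Finset.card_univ,
      Fintype.card_fin, smul_eq_mul]
  · intro U hU
    have := (edgeOf_isSome.1 (Finset.mem_filter.1 hU).2).1
    refine Finset.mem_coe.2 (Finset.mem_powersetCard.2 ⟨Finset.subset_univ _, ?_⟩)
    omega

lemma edgeOf_trans_perm (π : Equiv.Perm (Fin n)) {T U : Tuples n ℓ} {S S' : Hyperedge n p}
    (hS : ∀ s, π s ∈ S'.1 ↔ s ∈ S.1) :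
    edgeOf p (T.trans π.toEmbedding) (U.trans π.toEmbedding) = some S' ↔
      edgeOf p T U = some S := by
  have hd : diffSet (T.trans π.toEmbedding) (U.trans π.toEmbedding) = diffSet T U := by
    ext a; simp [mem_diffSet]
  rw [edgeOf_eq_some_iff, edgeOf_eq_some_iff, hd]
  refine and_congr Iff.rfl (and_congr (by simp) ?_)
  rw [← π.forall_congr_right]
  refine forall_congr' fun s => ?_
  rw [hS s]
  simp

/-- Every hyperedge labels the same number of entries of the Kikuchi matrix. -/
lemma card_pairs_edgeOf_eq (S S' : Hyperedge n p) :
    (Finset.univ.filter fun TU : Tuples n ℓ × Tuples n ℓ =>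
      edgeOf p TU.1 TU.2 = some S).card =
    (Finset.univ.filter fun TU : Tuples n ℓ × Tuples n ℓ =>
      edgeOf p TU.1 TU.2 = some S').card := by
  have e : {x // x ∈ S.1} ≃ {x // x ∈ S'.1} :=
    Fintype.equivOfCardEq (by simp [S.2, S'.2])
  set π : Equiv.Perm (Fin n) := e.extendSubtype with hπ
  have hS : ∀ s, π s ∈ S'.1 ↔ s ∈ S.1 := fun s =>
    ⟨fun h => by
      by_contra hs
      exact e.extendSubtype_not_mem s hs h, fun h => e.extendSubtype_mem s h⟩
  have hbij : Function.Bijective fun T : Tuples n ℓ => T.trans π.toEmbedding :=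
    ⟨fun T U h => by
      ext a
      have := DFunLike.congr_fun h a
      simpa using congrArg Fin.val (π.injective this),
     fun T => ⟨T.trans π.symm.toEmbedding, by ext a; simp⟩⟩
  refine Finset.card_bijective (Prod.map _ _) (hbij.prodMap hbij) fun TU => ?_
  simp only [Finset.mem_filter, Finset.mem_univ, true_and, Prod.map_fst, Prod.map_snd]
  exact (edgeOf_trans_perm π hS).symm

lemma card_pairs_edgeOf_mul {q : ℕ} (S : Hyperedge n (2 * q)) :
    (Finset.univ.filter fun TU : Tuples n ℓ × Tuples n ℓ =>
      edgeOf (2 * q) TU.1 TU.2 = some S).card * n.choose (2 * q) =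
    Fintype.card (Tuples n ℓ) * (ℓ.choose q * (n - ℓ).descFactorial q) := by
  have hE : Fintype.card (Hyperedge n (2 * q)) = n.choose (2 * q) := by
    rw [Fintype.card_finset_len, Fintype.card_fin]
  have h1 : ∑ S' : Hyperedge n (2 * q), (Finset.univ.filter fun TU : Tuples n ℓ × Tuples n ℓ =>
      edgeOf (2 * q) TU.1 TU.2 = some S').card =
      (Finset.univ.filter fun TU : Tuples n ℓ × Tuples n ℓ =>
        (edgeOf (2 * q) TU.1 TU.2).isSome).card := by
    simp_rw [Finset.card_filter]
    rw [Finset.sum_comm]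
    refine Finset.sum_congr rfl fun TU _ => ?_
    cases edgeOf (2 * q) TU.1 TU.2 <;> simp
  have h2 : (Finset.univ.filter fun TU : Tuples n ℓ × Tuples n ℓ =>
        (edgeOf (2 * q) TU.1 TU.2).isSome).card =
      ∑ T : Tuples n ℓ, (Finset.univ.filter fun U => (edgeOf (2 * q) T U).isSome).card := by
    simp_rw [Finset.card_filter]
    exact Fintype.sum_prod_type _
  rw [h2, Finset.sum_congr rfl fun T _ => card_edgeOf_isSome T, Finset.sum_const,
    Finset.sum_congr rfl fun S' _ => card_pairs_edgeOf_eq S' S, Finset.sum_const,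
    Finset.card_univ, Finset.card_univ, hE, smul_eq_mul, smul_eq_mul] at h1
  rw [mul_comm, h1]

lemma prod_mul_prod_of_edgeOf {w : Fin n → ℝ} (hw : ∀ s, w s * w s = 1) {T U : Tuples n ℓ}
    {S : Hyperedge n p} (h : edgeOf p T U = some S) :
    (∏ a, w (T a)) * (∏ a, w (U a)) = ∏ s ∈ S.1, w s := by
  obtain ⟨_, hn, hS⟩ := edgeOf_eq_some.1 h
  rw [← hS, List.prod_toFinset _ hn, ominus, List.map_append, List.prod_append, List.map_map,
    List.map_map, ← List.prod_toFinset _ (disagreements_nodup T U),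
    ← List.prod_toFinset _ (disagreements_nodup T U), disagreements_toFinset,
    ← Finset.prod_mul_distrib, ← Finset.prod_mul_distrib]
  symm
  refine Finset.prod_subset (Finset.subset_univ _) fun a _ ha => ?_
  rw [mem_diffSet, not_not] at ha
  simp [ha, hw]

/-- The quadratic form of the Kikuchi matrix at a tensor power of a sign vector. -/
lemma quadratic_form_edgeMatrix {q : ℕ} {w : Fin n → ℝ} (hw : ∀ s, w s * w s = 1)
    (hn : 2 * q ≤ n) (A : Hyperedge n (2 * q) → ℝ) :
    (fun T : Tuples n ℓ => ∏ a, w (T a)) ⬝ᵥ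
        (edgeMatrix (edgeOf (2 * q)) A).mulVec (fun T : Tuples n ℓ => ∏ a, w (T a)) =
      Fintype.card (Tuples n ℓ) * ((ℓ.choose q * (n - ℓ).descFactorial q : ℕ) : ℝ) *
        ((∑ S, A S * ∏ s ∈ S.1, w s) / n.choose (2 * q)) := by
  have hc : (0 : ℝ) < n.choose (2 * q) := by exact_mod_cast Nat.choose_pos hn
  have h1 : (fun T : Tuples n ℓ => ∏ a, w (T a)) ⬝ᵥ
        (edgeMatrix (edgeOf (2 * q)) A).mulVec (fun T : Tuples n ℓ => ∏ a, w (T a)) =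
      ∑ TU : Tuples n ℓ × Tuples n ℓ, ∑ S,
        if edgeOf (2 * q) TU.1 TU.2 = some S then A S * ∏ s ∈ S.1, w s else 0 := by
    rw [Fintype.sum_prod_type]
    simp only [dotProduct, Matrix.mulVec, Finset.mul_sum]
    refine Finset.sum_congr rfl fun T _ => Finset.sum_congr rfl fun U _ => ?_
    cases hU : edgeOf (2 * q) T U with
    | none => simp [edgeMatrix, hU]
    | some S =>
      simp only [edgeMatrix, hU, Option.elim_some, Option.some.injEq, Finset.sum_ite_eq,
        Finset.mem_univ, if_true]
      rw [← prod_mul_prod_of_edgeOf hw hU]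
      ring
  rw [h1, Finset.sum_comm, mul_div_assoc', eq_div_iff hc.ne', Finset.sum_mul, Finset.mul_sum]
  refine Finset.sum_congr rfl fun S _ => ?_
  rw [← Finset.sum_filter, Finset.sum_const, nsmul_eq_mul]
  have := card_pairs_edgeOf_mul (ℓ := ℓ) S
  have h2 : (((Finset.univ.filter fun TU : Tuples n ℓ × Tuples n ℓ =>
      edgeOf (2 * q) TU.1 TU.2 = some S).card : ℕ) : ℝ) * n.choose (2 * q) =
    Fintype.card (Tuples n ℓ) * ((ℓ.choose q * (n - ℓ).descFactorial q : ℕ) : ℝ) := by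
    exact_mod_cast this
  rw [← h2]
  ring

end Labels

end HSBM

namespace HSBM

/-! ### The null law -/

instance (q : ℝ) : IsProbabilityMeasure (bern q) := by
  unfold bern; infer_instance

instance (n p : ℕ) (θ₀ : ℝ) : IsProbabilityMeasure (nullLaw n p θ₀) := by
  unfold nullLaw; infer_instance

instance (n p : ℕ) {k : ℕ} (θ₀ ε : ℝ) (x : Fin n → Fin k) :
    IsProbabilityMeasure (condLaw n p θ₀ ε x) := by
  unfold condLaw; infer_instance

lemma integral_bern {q : ℝ} (h0 : 0 ≤ q) (h1 : q ≤ 1) (g : Bool → ℝ) :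
    ∫ b, g b ∂(bern q) = q * g true + (1 - q) * g false := by
  unfold bern
  rw [integral_bernoulliMeasure, Set.projIcc_of_mem _ ⟨h0, h1⟩]
  simp

/-- The normalized value of one indicator. -/
noncomputable def normalizedBit (θ₀ : ℝ) (b : Bool) : ℝ :=
  ((if b then (1 : ℝ) else 0) - θ₀) / √(θ₀ * (1 - θ₀))

lemma integral_normalizedBit_pow_le {θ₀ : ℝ} (h0 : 0 < θ₀) (h1 : θ₀ < 1 / 2) (L : ℝ) (j : ℕ) :
    |∫ b, normalizedBit θ₀ b ^ j ∂(bern θ₀)| ≤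
      momentGen ((1 - θ₀) / √(θ₀ * (1 - θ₀))) L j 0 := by
  have hv : 0 < θ₀ * (1 - θ₀) := mul_pos h0 (by linarith)
  have hs : 0 < √(θ₀ * (1 - θ₀)) := Real.sqrt_pos.2 hv
  have hs2 : √(θ₀ * (1 - θ₀)) ^ 2 = θ₀ * (1 - θ₀) := Real.sq_sqrt hv.le
  set s := √(θ₀ * (1 - θ₀)) with hsdef
  have hint : ∀ g : Bool → ℝ, ∫ b, g b ∂(bern θ₀) = θ₀ * g true + (1 - θ₀) * g false :=
    integral_bern h0.le (by linarith)
  match j with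
  | 0 => rw [hint]; simp [momentGen]
  | 1 =>
    rw [hint]
    simp only [normalizedBit, momentGen, if_true, Bool.false_eq_true, if_false, mul_zero,
      Real.exp_zero, sub_self, zero_div, pow_one]
    refine le_of_eq (abs_eq_zero.2 ?_)
    ring
  | j + 2 =>
    have habs : ∀ b, |normalizedBit θ₀ b| ≤ (1 - θ₀) / s := by
      intro b
      unfold normalizedBit
      rw [abs_div, abs_of_pos hs]
      gcongr
      cases b
      · simp only [Bool.false_eq_true, if_false, zero_sub, abs_neg, abs_of_pos h0]; linarith
      · simp only [if_true]; rw [abs_of_nonneg (by linarith)]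
    calc |∫ b, normalizedBit θ₀ b ^ (j + 2) ∂(bern θ₀)|
        ≤ ∫ b, |normalizedBit θ₀ b ^ (j + 2)| ∂(bern θ₀) := abs_integral_le_integral_abs
      _ ≤ ∫ b, ((1 - θ₀) / s) ^ j * normalizedBit θ₀ b ^ 2 ∂(bern θ₀) := by
          refine integral_mono Integrable.of_finite Integrable.of_finite fun b => ?_
          simp only [pow_add, abs_mul, abs_pow, sq_abs]
          gcongr
          exact habs b
      _ = momentGen ((1 - θ₀) / s) L (j + 2) 0 := by
          rw [integral_const_mul, hint]
          simp only [momentGen, mul_zero, Real.exp_zero, mul_one]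
          have : θ₀ * normalizedBit θ₀ true ^ 2 + (1 - θ₀) * normalizedBit θ₀ false ^ 2 = 1 := by
            simp only [normalizedBit, if_true, Bool.false_eq_true, if_false]
            rw [← hsdef, div_pow, div_pow, hs2]
            have : (1 - θ₀) ≠ 0 := by linarith
            field_simp
            ring
          rw [this, mul_one]

lemma kikuchi_edgeMatrix_isHermitian {n p : ℕ} (ℓ : ℕ) (θ₀ : ℝ) (Y : Hypergraph n p) :
    (edgeMatrix (edgeOf (ℓ := ℓ) p) (normalized θ₀ Y)).IsHermitian := by
  rw [← kikuchi_tensor_eq]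
  exact kikuchi_isHermitian ℓ θ₀ Y

lemma nonempty_tuples {n ℓ : ℕ} (h : ℓ ≤ n) : Nonempty (Tuples n ℓ) :=
  ⟨(Fin.castLEEmb h)⟩

/-- Chernoff bound for the largest eigenvalue of the Kikuchi matrix under the null law. -/
lemma nullLaw_kikuchiMax_ge_le {n ℓ q : ℕ} {θ₀ : ℝ} (h0 : 0 < θ₀) (h1 : θ₀ < 1 / 2) (hℓ : ℓ ≤ n)
    {x : ℝ} (hx : 0 ≤ x) (t : ℝ) {L₀ h d : ℝ}
    (hL₀ : L₀ = (1 - θ₀) / √(θ₀ * (1 - θ₀))) (hh : h = q.factorial)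
    (hd : d = (ℓ.choose q * (n - ℓ).descFactorial q : ℕ)) :
    (nullLaw n (2 * q) θ₀).real {Y | t ≤ kikuchiMax ℓ θ₀ Y} ≤
      Fintype.card (Tuples n ℓ) *
        Real.exp (d / (L₀ * (h * L₀)) * (Real.exp (h * L₀ * x) - h * L₀ * x - 1) - x * t) := by
  have := nonempty_tuples hℓ
  have hL₀pos : 0 < L₀ := by
    rw [hL₀]
    exact div_pos (by linarith) (Real.sqrt_pos.2 (mul_pos h0 (by linarith)))
  have hhpos : 0 < h := by rw [hh]; exact_mod_cast q.factorial_pos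
  have hexp := integral_exp_lambdaMax_le (nullLaw n (2 * q) θ₀) (edgeOf (ℓ := ℓ) (2 * q))
    (normalized θ₀) (d := d) hL₀pos hhpos (kikuchi_edgeMatrix_isHermitian ℓ θ₀)
    (fun T S => by rw [hh]; exact_mod_cast card_fiber_edgeOf_le T S)
    (fun T => by rw [hd, card_edgeOf_isSome])
    (fun j => by
      have hprod : ∫ Y, ∏ S, normalized θ₀ Y S ^ j S ∂(nullLaw n (2 * q) θ₀) =
          ∏ S, ∫ b, normalizedBit θ₀ b ^ j S ∂(bern θ₀) :=
        integral_fintype_prod_eq_prod (fun (S : Hyperedge n (2 * q)) b => normalizedBit θ₀ b ^ j S)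
      rw [hprod, Finset.abs_prod]
      simp only [walkGen, mul_zero, Real.exp_zero, sub_zero, sub_self, one_mul]
      exact Finset.prod_le_prod (fun _ _ => abs_nonneg _)
        fun S _ => hL₀ ▸ integral_normalizedBit_pow_le h0 h1 _ (j S)) hx
  have hmarkov := mul_meas_ge_le_integral_of_nonneg (μ := nullLaw n (2 * q) θ₀)
    (f := fun Y => Real.exp (x * kikuchiMax ℓ θ₀ Y)) (ae_of_all _ fun _ => (Real.exp_pos _).le)
    Integrable.of_finite (Real.exp (x * t))
  have hsub : (nullLaw n (2 * q) θ₀).real {Y | t ≤ kikuchiMax ℓ θ₀ Y} ≤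
      (nullLaw n (2 * q) θ₀).real {Y | Real.exp (x * t) ≤ Real.exp (x * kikuchiMax ℓ θ₀ Y)} :=
    measureReal_mono fun Y hY => Real.exp_le_exp.2 (mul_le_mul_of_nonneg_left hY hx)
  simp only [kikuchiMax, kikuchi_tensor_eq] at hmarkov hsub ⊢
  rw [Real.exp_sub, mul_div_assoc', le_div_iff₀ (Real.exp_pos _), mul_comm]
  exact (mul_le_mul_of_nonneg_left hsub (Real.exp_pos _).le).trans (hmarkov.trans hexp)

lemma snr_pos {θ₀ ε : ℝ} (hε : 0 < ε) (hθ : ε < θ₀) (h1 : θ₀ < 1 / 2) : 0 < snr θ₀ ε :=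
  div_pos hε (Real.sqrt_pos.2 (mul_pos (hε.trans hθ) (by linarith)))

lemma choose_mul_descFactorial_mul_le (n ℓ q : ℕ) :
    (ℓ.choose q * (n - ℓ).descFactorial q) * q.factorial ≤ n ^ q * ℓ ^ q := by
  have h1 : ℓ.choose q * q.factorial ≤ ℓ ^ q := by
    rw [mul_comm, ← Nat.descFactorial_eq_factorial_mul_choose]
    exact Nat.descFactorial_le_pow _ _
  have h2 : (n - ℓ).descFactorial q ≤ n ^ q :=
    (Nat.descFactorial_le_pow _ _).trans (Nat.pow_le_pow_left (Nat.sub_le _ _) _)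
  calc _ = (n - ℓ).descFactorial q * (ℓ.choose q * q.factorial) := by ring
    _ ≤ _ := Nat.mul_le_mul h2 h1

/-- Under the null law the largest eigenvalue is small with high probability. -/
lemma nullLaw_kikuchiMax_le {n ℓ q : ℕ} {θ₀ ε C : ℝ} (hε : 0 < ε) (hθ : ε < θ₀)
    (h1 : θ₀ < 1 / 2) (hℓ : ℓ ≤ n) (hℓ1 : 1 ≤ ℓ) (hC : 0 < C) (hCq : C * q.factorial ≤ 1) {t : ℝ}
    (ht : t = C / 3 * snr θ₀ ε * ((n : ℝ) ^ q * (ℓ : ℝ) ^ q))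
    (ht2 : 6 * ((n : ℝ) ^ q * (ℓ : ℝ) ^ q) * (ℓ * Real.log n) ≤ t ^ 2) :
    (nullLaw n (2 * q) θ₀).real {Y | t ≤ kikuchiMax ℓ θ₀ Y} ≤
      Real.exp (-(ℓ * Real.log n) / 2) := by
  have h0 : 0 < θ₀ := hε.trans hθ
  have hβ := snr_pos hε hθ h1
  set β := snr θ₀ ε with hβdef
  have hnpos : (0 : ℝ) < n := by exact_mod_cast (by omega : 0 < n)
  have hℓpos : (0 : ℝ) < ℓ := by exact_mod_cast hℓ1
  set σ : ℝ := (n : ℝ) ^ q * (ℓ : ℝ) ^ q with hσ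
  have hσpos : 0 < σ := by positivity
  have htpos : 0 < t := by rw [ht]; positivity
  have hv : 0 < θ₀ * (1 - θ₀) := mul_pos h0 (by linarith)
  have hs : 0 < √(θ₀ * (1 - θ₀)) := Real.sqrt_pos.2 hv
  have hs2 : √(θ₀ * (1 - θ₀)) ^ 2 = θ₀ * (1 - θ₀) := Real.sq_sqrt hv.le
  set L₀ := (1 - θ₀) / √(θ₀ * (1 - θ₀)) with hL₀
  have hL₀pos : 0 < L₀ := div_pos (by linarith) hs
  have hLβ : L₀ * β ≤ 1 := by
    rw [hβdef, snr, hL₀, div_mul_div_comm, div_le_one (by positivity), ← sq, hs2]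
    nlinarith
  set h : ℝ := (q.factorial : ℝ) with hh
  have hhpos : 0 < h := by rw [hh]; exact_mod_cast q.factorial_pos
  set d : ℝ := ((ℓ.choose q * (n - ℓ).descFactorial q : ℕ) : ℝ) with hd
  have hd0 : 0 ≤ d := by positivity
  have hdh : d * h ≤ σ := by
    rw [hd, hh, hσ]
    exact_mod_cast choose_mul_descFactorial_mul_le n ℓ q
  set x : ℝ := t / (2 * σ) with hx
  have hx0 : 0 < x := by positivity
  have hu : h * L₀ * x ≤ 1 := by
    have : h * L₀ * x = (C * h) * (L₀ * β) / 6 := by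
      rw [hx, ht]
      field_simp
      norm_num
    rw [this]
    have : (C * h) * (L₀ * β) ≤ 1 * 1 :=
      mul_le_mul hCq hLβ (by positivity) zero_le_one
    linarith
  have hu0 : 0 ≤ h * L₀ * x := by positivity
  have hexp : Real.exp (h * L₀ * x) - h * L₀ * x - 1 ≤ (h * L₀ * x) ^ 2 := by
    have := (abs_le.1 (Real.abs_exp_sub_one_sub_id_le (x := h * L₀ * x)
      (by rwa [abs_of_nonneg hu0]))).2
    linarith
  have hψ : d / (L₀ * (h * L₀)) * (Real.exp (h * L₀ * x) - h * L₀ * x - 1) ≤ σ * x ^ 2 := by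
    calc _ ≤ d / (L₀ * (h * L₀)) * (h * L₀ * x) ^ 2 := by gcongr
      _ = d * h * x ^ 2 := by field_simp
      _ ≤ σ * x ^ 2 := by gcongr
  have hexponent : σ * x ^ 2 - x * t ≤ -(3 / 2) * (ℓ * Real.log n) := by
    have : σ * x ^ 2 - x * t = -(t ^ 2 / (4 * σ)) := by
      rw [hx]; field_simp; ring
    rw [this]
    have : 3 / 2 * (ℓ * Real.log n) ≤ t ^ 2 / (4 * σ) := by
      rw [le_div_iff₀ (by positivity)]
      linarith
    linarith
  have hcard : (Fintype.card (Tuples n ℓ) : ℝ) ≤ Real.exp (ℓ * Real.log n) := by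
    rw [mul_comm, Real.exp_mul, Real.exp_log hnpos, Real.rpow_natCast]
    rw [Fintype.card_embedding_eq, Fintype.card_fin, Fintype.card_fin]
    exact_mod_cast Nat.descFactorial_le_pow _ _
  calc _ ≤ Fintype.card (Tuples n ℓ) *
        Real.exp (d / (L₀ * (h * L₀)) * (Real.exp (h * L₀ * x) - h * L₀ * x - 1) - x * t) :=
        nullLaw_kikuchiMax_ge_le h0 h1 hℓ hx0.le t hL₀ hh hd
    _ ≤ Real.exp (ℓ * Real.log n) * Real.exp (-(3 / 2) * (ℓ * Real.log n)) := by
        gcongr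
        linarith
    _ = _ := by
        rw [← Real.exp_add]
        congr 1
        ring

end HSBM

namespace HSBM

/-! ### The planted law -/

section Planted

variable {n k p : ℕ}

/-- The centered indicator `1_{a = i} - 1/k`. -/
noncomputable def centered (i a : Fin k) : ℝ := (if a = i then (1 : ℝ) else 0) - 1 / (k : ℝ)

lemma f_restrictLabels (x : Fin n → Fin k) (S : Hyperedge n p) :
    f (restrictLabels x S) = ∑ i, ∏ s ∈ S.1, centered i (x s) := by
  unfold f restrictLabels
  refine Finset.sum_congr rfl fun i _ => ?_
  conv_rhs => rw [← Finset.map_orderEmbOfFin_univ S.1 S.2, Finset.prod_map]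
  rfl

lemma abs_centered_le_one (i a : Fin k) : |centered i a| ≤ 1 := by
  have hk : (1 : ℝ) ≤ k := by exact_mod_cast (Fin.pos a)
  have h1 : 1 / (k : ℝ) ≤ 1 := by rw [div_le_one (by linarith)]; exact hk
  have h0 : 0 ≤ 1 / (k : ℝ) := by positivity
  unfold centered
  rw [abs_le]
  split_ifs <;> constructor <;> linarith

lemma sum_centered_sq_le_one (a : Fin k) : ∑ i, centered i a ^ 2 ≤ 1 := by
  have hk : (1 : ℝ) ≤ k := by exact_mod_cast (Fin.pos a)
  have h : ∀ i, centered i a ^ 2 =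
      (if a = i then (1 : ℝ) else 0) * (1 - 2 / k) + 1 / (k : ℝ) ^ 2 := by
    intro i
    unfold centered
    split_ifs <;> ring
  simp_rw [h]
  rw [Finset.sum_add_distrib, ← Finset.sum_mul]
  simp only [Finset.sum_ite_eq, Finset.mem_univ, if_true, Finset.sum_const, Finset.card_univ,
    Fintype.card_fin, nsmul_eq_mul]
  have : (1 : ℝ) * (1 - 2 / k) + k * (1 / (k : ℝ) ^ 2) = 1 - 1 / k := by
    field_simp; ring
  rw [this]
  have : 0 ≤ 1 / (k : ℝ) := by positivity
  linarith

lemma abs_f_le_one (hp : 2 ≤ p) (a : Fin p → Fin k) : |f a| ≤ 1 := by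
  set j₀ : Fin p := ⟨0, by omega⟩
  set j₁ : Fin p := ⟨1, by omega⟩
  have hne : j₁ ≠ j₀ := by simp [j₀, j₁]
  have hterm : ∀ i : Fin k, |∏ j, centered i (a j)| ≤
      (centered i (a j₀) ^ 2 + centered i (a j₁) ^ 2) / 2 := by
    intro i
    rw [Finset.abs_prod, ← Finset.mul_prod_erase _ _ (Finset.mem_univ j₀),
      ← Finset.mul_prod_erase _ _ (Finset.mem_erase.2 ⟨hne, Finset.mem_univ j₁⟩)]
    have h1 : ∏ j ∈ (Finset.univ.erase j₀).erase j₁, |centered i (a j)| ≤ 1 :=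
      Finset.prod_le_one (fun _ _ => abs_nonneg _) fun j _ => abs_centered_le_one i (a j)
    have h2 := sq_nonneg (|centered i (a j₀)| - |centered i (a j₁)|)
    have h3 : |centered i (a j₁)| * ∏ j ∈ (Finset.univ.erase j₀).erase j₁, |centered i (a j)| ≤
        |centered i (a j₁)| := mul_le_of_le_one_right (abs_nonneg _) h1
    have h4 := mul_le_mul_of_nonneg_left h3 (abs_nonneg (centered i (a j₀)))
    rw [sub_sq, sq_abs, sq_abs] at h2
    linarith
  calc |f a| ≤ ∑ i, |∏ j, centered i (a j)| := Finset.abs_sum_le_sum_abs _ _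
    _ ≤ ∑ i, (centered i (a j₀) ^ 2 + centered i (a j₁) ^ 2) / 2 :=
        Finset.sum_le_sum fun i _ => hterm i
    _ = (∑ i, centered i (a j₀) ^ 2 + ∑ i, centered i (a j₁) ^ 2) / 2 := by
        rw [← Finset.sum_div, Finset.sum_add_distrib]
    _ ≤ 1 := by
        have := sum_centered_sq_le_one (a j₀)
        have := sum_centered_sq_le_one (a j₁)
        linarith

/-- The sign separating the label `0` from the others. -/
def labelSign (a : Fin k) : ℝ := if a.val = 0 then 1 else -1

lemma labelSign_mul_self (a : Fin k) : labelSign a * labelSign a = 1 := by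
  unfold labelSign; split_ifs <;> norm_num

/-- The mean of a function of a uniform label. -/
noncomputable def labelMean (u : Fin k → ℝ) : ℝ := (∑ a, u a) / k

/-- The mean correlation of a hyperedge with the sign vector. -/
noncomputable def signalStrength (k p : ℕ) : ℝ :=
  ∑ i : Fin k, labelMean (fun a => labelSign a * centered i a) ^ p

lemma signalStrength_pos (hk : 2 ≤ k) (hpe : Even p) : 0 < signalStrength k p := by
  have hk0 : (0 : ℝ) < k := by exact_mod_cast (by omega : 0 < k)
  have hk1 : (2 : ℝ) ≤ k := by exact_mod_cast hk
  refine Finset.sum_pos' (fun i _ => hpe.pow_nonneg _) ⟨⟨0, by omega⟩, Finset.mem_univ _, ?_⟩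
  set i₀ : Fin k := ⟨0, by omega⟩ with hi₀
  refine hpe.pow_pos (ne_of_gt (div_pos ?_ hk0))
  have hsum : ∑ a : Fin k, labelSign a = 2 - k := by
    have : ∀ a : Fin k, labelSign a = (if a = i₀ then 2 else 0) - 1 := by
      intro a
      unfold labelSign
      by_cases h : a = i₀
      · simp [h, hi₀]; norm_num
      · have : a.val ≠ 0 := fun h' => h (Fin.ext h')
        simp [h, this]
    simp_rw [this, Finset.sum_sub_distrib]
    simp
  have : ∀ a : Fin k, labelSign a * centered i₀ a =
      (if a = i₀ then labelSign a else 0) - labelSign a * (1 / k) := by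
    intro a
    unfold centered
    split_ifs <;> ring
  simp_rw [this, Finset.sum_sub_distrib, ← Finset.sum_mul, hsum]
  simp only [Finset.sum_ite_eq', Finset.mem_univ, if_true]
  have h1 : labelSign i₀ = 1 := by simp [labelSign, hi₀]
  rw [h1]
  have : (2 - (k : ℝ)) * (1 / k) ≤ 0 := mul_nonpos_of_nonpos_of_nonneg (by linarith)
    (by positivity)
  linarith

lemma sum_prod_mul_prod (hk : 0 < k) {S S' : Finset (Fin n)} (hd : Disjoint S S')
    (u v : Fin k → ℝ) :
    (∑ x : Fin n → Fin k, (∏ s ∈ S, u (x s)) * ∏ s ∈ S', v (x s)) / (k : ℝ) ^ n =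
      labelMean u ^ S.card * labelMean v ^ S'.card := by
  have hk0 : (k : ℝ) ≠ 0 := by exact_mod_cast hk.ne'
  have h1 : ∀ x : Fin n → Fin k, (∏ s ∈ S, u (x s)) * ∏ s ∈ S', v (x s) =
      ∏ s, ((if s ∈ S then u (x s) else 1) * (if s ∈ S' then v (x s) else 1)) := by
    intro x
    rw [Finset.prod_mul_distrib, Finset.prod_ite_mem, Finset.prod_ite_mem, Finset.univ_inter,
      Finset.univ_inter]
  have h2 := Finset.prod_univ_sum (fun _ : Fin n => (Finset.univ : Finset (Fin k)))
    (fun s a => (if s ∈ S then u a else 1) * (if s ∈ S' then v a else 1))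
  rw [Fintype.piFinset_univ] at h2
  simp_rw [h1]
  rw [← h2]
  have h3 : ∀ s : Fin n, ∑ a, ((if s ∈ S then u a else 1) * (if s ∈ S' then v a else 1)) =
      k * ((if s ∈ S then labelMean u else 1) * (if s ∈ S' then labelMean v else 1)) := by
    intro s
    by_cases hs : s ∈ S
    · have hs' : s ∉ S' := Finset.disjoint_left.1 hd hs
      simp [hs, hs', labelMean]
      field_simp
    · by_cases hs' : s ∈ S'
      · simp [hs, hs', labelMean]
        field_simp
      · simp [hs, hs']
  simp_rw [h3]
  rw [Finset.prod_mul_distrib, Finset.prod_mul_distrib, Finset.prod_ite_mem, Finset.prod_ite_mem,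
    Finset.univ_inter, Finset.univ_inter]
  simp only [Finset.prod_const, Finset.card_univ, Fintype.card_fin]
  field_simp

/-- The correlation of the signal on a hyperedge with the sign vector. -/
noncomputable def edgeSignal (x : Fin n → Fin k) (S : Hyperedge n p) : ℝ :=
  f (restrictLabels x S) * ∏ s ∈ S.1, labelSign (x s)

lemma edgeSignal_eq (x : Fin n → Fin k) (S : Hyperedge n p) :
    edgeSignal x S = ∑ i, ∏ s ∈ S.1, (labelSign (x s) * centered i (x s)) := by
  rw [edgeSignal, f_restrictLabels, Finset.sum_mul]
  refine Finset.sum_congr rfl fun i _ => ?_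
  rw [Finset.prod_mul_distrib, mul_comm]

lemma abs_prod_labelSign (x : Fin n → Fin k) (S : Finset (Fin n)) :
    |∏ s ∈ S, labelSign (x s)| = 1 := by
  rw [Finset.abs_prod]
  refine Finset.prod_eq_one fun s _ => ?_
  unfold labelSign; split_ifs <;> simp

lemma abs_edgeSignal_le (hp : 2 ≤ p) (x : Fin n → Fin k) (S : Hyperedge n p) :
    |edgeSignal x S| ≤ 1 := by
  rw [edgeSignal, abs_mul, abs_prod_labelSign, mul_one]
  exact abs_f_le_one hp _

lemma mean_edgeSignal (hk : 0 < k) (S : Hyperedge n p) :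
    (∑ x : Fin n → Fin k, edgeSignal x S) / (k : ℝ) ^ n = signalStrength k p := by
  simp_rw [edgeSignal_eq]
  rw [Finset.sum_comm, Finset.sum_div]
  refine Finset.sum_congr rfl fun i _ => ?_
  have := sum_prod_mul_prod (n := n) hk (Finset.disjoint_empty_right S.1)
    (fun a => labelSign a * centered i a) (fun _ => 1)
  simpa [S.2] using this

lemma mean_edgeSignal_mul (hk : 0 < k) {S S' : Hyperedge n p} (hd : Disjoint S.1 S'.1) :
    (∑ x : Fin n → Fin k, edgeSignal x S * edgeSignal x S') / (k : ℝ) ^ n =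
      signalStrength k p ^ 2 := by
  simp_rw [edgeSignal_eq, Finset.sum_mul_sum]
  rw [Finset.sum_comm, Finset.sum_div, sq, signalStrength, Finset.sum_mul_sum]
  refine Finset.sum_congr rfl fun i _ => ?_
  rw [Finset.sum_comm, Finset.sum_div]
  refine Finset.sum_congr rfl fun i' _ => ?_
  have := sum_prod_mul_prod (n := n) hk hd
    (fun a => labelSign a * centered i a) (fun a => labelSign a * centered i' a)
  rwa [S.2, S'.2] at this

lemma signalStrength_le_one (hk : 0 < k) (hp : 2 ≤ p) : signalStrength k p ≤ 1 := by
  have hk0 : (0 : ℝ) < (k : ℝ) ^ p := by positivity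
  rw [← mean_edgeSignal (n := p) hk ⟨Finset.univ, by simp⟩, div_le_one hk0]
  refine (Finset.sum_le_sum fun x _ => (le_abs_self _).trans (abs_edgeSignal_le hp x _)).trans ?_
  simp

lemma card_hyperedges_mem (s : Fin n) :
    (Finset.univ.filter fun S : Hyperedge n p => s ∈ S.1).card ≤ (n - 1).choose (p - 1) := by
  have h : (Finset.powersetCard (p - 1) (Finset.univ.erase s)).card =
      (n - 1).choose (p - 1) := by
    rw [Finset.card_powersetCard, Finset.card_erase_of_mem (Finset.mem_univ s)]
    simp
  rw [← h]
  refine Finset.card_le_card_of_injOn (fun S => S.1.erase s) ?_ ?_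
  · intro S hS
    have hS' := (Finset.mem_filter.1 hS).2
    refine Finset.mem_coe.2 (Finset.mem_powersetCard.2
      ⟨Finset.erase_subset_erase _ (Finset.subset_univ _), ?_⟩)
    rw [Finset.card_erase_of_mem hS', S.2]
  · intro S hS S' hS' hE
    have h1 := (Finset.mem_filter.1 hS).2
    have h2 := (Finset.mem_filter.1 hS').2
    apply Subtype.ext
    rw [← Finset.insert_erase h1, ← Finset.insert_erase h2]
    exact congrArg _ hE

lemma card_not_disjoint_le (S : Hyperedge n p) :
    (Finset.univ.filter fun S' : Hyperedge n p => ¬ Disjoint S.1 S'.1).card ≤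
      p * (n - 1).choose (p - 1) := by
  calc _ ≤ (S.1.biUnion fun s => Finset.univ.filter fun S' : Hyperedge n p => s ∈ S'.1).card := by
        refine Finset.card_le_card fun S' hS' => ?_
        obtain ⟨s, hs, hs'⟩ := Finset.not_disjoint_iff.1 (Finset.mem_filter.1 hS').2
        simp only [Finset.mem_biUnion, Finset.mem_filter, Finset.mem_univ, true_and]
        exact ⟨s, hs, hs'⟩
    _ ≤ S.1.card * (n - 1).choose (p - 1) :=
        Finset.card_biUnion_le_card_mul _ _ _ fun s _ => card_hyperedges_mem s
    _ = _ := by rw [S.2]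

lemma card_hyperedge : Fintype.card (Hyperedge n p) = n.choose p := by
  rw [Fintype.card_finset_len, Fintype.card_fin]

/-- The average signal concentrates around its mean. -/
lemma mean_sq_signal_sub_le (hk : 0 < k) (hp : 2 ≤ p) (hpe : Even p) (hn : p ≤ n) :
    (∑ x : Fin n → Fin k, ((∑ S : Hyperedge n p, edgeSignal x S) / n.choose p -
      signalStrength k p) ^ 2) / (k : ℝ) ^ n ≤ 4 * (p : ℝ) ^ 2 / n := by
  set M := signalStrength k p with hM
  have hkn : (0 : ℝ) < (k : ℝ) ^ n := by positivity
  have hN : (0 : ℝ) < n.choose p := by exact_mod_cast Nat.choose_pos hn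
  have hn0 : (0 : ℝ) < n := by exact_mod_cast (by omega : 0 < n)
  have hM1 : M ≤ 1 := signalStrength_le_one hk hp
  have hM0 : 0 ≤ M := Finset.sum_nonneg fun i _ => hpe.pow_nonneg _
  have hcov : ∀ S S' : Hyperedge n p,
      (∑ x : Fin n → Fin k, (edgeSignal x S - M) * (edgeSignal x S' - M)) / (k : ℝ) ^ n ≤
        if Disjoint S.1 S'.1 then 0 else 4 := by
    intro S S'
    split_ifs with hd
    · have hexp : ∀ x : Fin n → Fin k, (edgeSignal x S - M) * (edgeSignal x S' - M) =
          edgeSignal x S * edgeSignal x S' - M * edgeSignal x S - M * edgeSignal x S' + M ^ 2 :=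
        fun x => by ring
      simp_rw [hexp]
      rw [Finset.sum_add_distrib, Finset.sum_sub_distrib, Finset.sum_sub_distrib,
        ← Finset.mul_sum, ← Finset.mul_sum, add_div, sub_div, sub_div, mul_div_assoc,
        mul_div_assoc, mean_edgeSignal_mul hk hd, mean_edgeSignal hk, mean_edgeSignal hk]
      simp only [Finset.sum_const, Finset.card_univ, Fintype.card_fun, Fintype.card_fin,
        nsmul_eq_mul]
      push_cast
      rw [mul_div_cancel_left₀ _ hkn.ne', ← hM]
      exact le_of_eq (by ring)
    · rw [div_le_iff₀ hkn]
      have hle : ∀ x : Fin n → Fin k, (edgeSignal x S - M) * (edgeSignal x S' - M) ≤ 4 := by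
        intro x
        have h1 := abs_edgeSignal_le hp x S
        have h2 := abs_edgeSignal_le hp x S'
        have h3 : |edgeSignal x S - M| ≤ 2 := by
          rw [abs_le] at h1 ⊢
          constructor <;> linarith
        have h4 : |edgeSignal x S' - M| ≤ 2 := by
          rw [abs_le] at h2 ⊢
          constructor <;> linarith
        calc _ ≤ |edgeSignal x S - M| * |edgeSignal x S' - M| := by
              rw [← abs_mul]; exact le_abs_self _
          _ ≤ 2 * 2 := mul_le_mul h3 h4 (abs_nonneg _) (by norm_num)
          _ = 4 := by norm_num
      refine (Finset.sum_le_sum fun x _ => hle x).trans ?_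
      simp [mul_comm]
  have hsq : ∀ x : Fin n → Fin k, ((∑ S : Hyperedge n p, edgeSignal x S) / n.choose p - M) ^ 2 =
      (∑ S : Hyperedge n p, ∑ S' : Hyperedge n p,
        (edgeSignal x S - M) * (edgeSignal x S' - M)) / (n.choose p : ℝ) ^ 2 := by
    intro x
    rw [← Finset.sum_mul_sum, ← sq, Finset.sum_sub_distrib]
    simp only [Finset.sum_const, Finset.card_univ, card_hyperedge, nsmul_eq_mul]
    rw [← div_pow, sub_div, mul_div_cancel_left₀ _ hN.ne']
  simp_rw [hsq]
  rw [← Finset.sum_div, div_div, mul_comm, ← div_div, Finset.sum_comm, Finset.sum_div]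
  have hcount : ∀ S : Hyperedge n p,
      (∑ x : Fin n → Fin k, ∑ S' : Hyperedge n p,
        (edgeSignal x S - M) * (edgeSignal x S' - M)) / (k : ℝ) ^ n ≤
      4 * (p * ((n - 1).choose (p - 1) : ℝ)) := by
    intro S
    rw [Finset.sum_comm, Finset.sum_div]
    refine (Finset.sum_le_sum fun S' _ => hcov S S').trans ?_
    rw [Finset.sum_ite]
    simp only [Finset.sum_const_zero, zero_add, Finset.sum_const, nsmul_eq_mul]
    rw [mul_comm]
    have := card_not_disjoint_le S
    have h2 : ((Finset.univ.filter fun S' : Hyperedge n p => ¬ Disjoint S.1 S'.1).card : ℝ) ≤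
      p * ((n - 1).choose (p - 1) : ℝ) := by exact_mod_cast this
    linarith
  have hid : (n : ℝ) * ((n - 1).choose (p - 1) : ℝ) = n.choose p * p := by
    obtain ⟨n', rfl⟩ : ∃ n', n = n' + 1 := ⟨n - 1, by omega⟩
    obtain ⟨p', rfl⟩ : ∃ p', p = p' + 1 := ⟨p - 1, by omega⟩
    have := Nat.add_one_mul_choose_eq n' p'
    simp only [Nat.add_sub_cancel]
    exact_mod_cast this
  rw [div_le_div_iff₀ (by positivity) hn0]
  calc _ ≤ (∑ S : Hyperedge n p, 4 * (p * ((n - 1).choose (p - 1) : ℝ))) * n := by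
        gcongr with S _
        exact hcount S
    _ = n.choose p * 4 * p * (n * ((n - 1).choose (p - 1) : ℝ)) := by
        simp only [Finset.sum_const, Finset.card_univ, card_hyperedge, nsmul_eq_mul]
        ring
    _ = _ := by rw [hid]; ring

/-- The average correlation of the normalized indicators with the sign vector of the labels. -/
noncomputable def correlation (θ₀ : ℝ) (x : Fin n → Fin k) (Y : Hypergraph n p) : ℝ :=
  (∑ S, normalized θ₀ Y S * ∏ s ∈ S.1, labelSign (x s)) / n.choose p

lemma condLaw_mean_sq_le (hp : 2 ≤ p) (hn : p ≤ n) {θ₀ ε : ℝ} (hε : 0 < ε) (hθ : ε < θ₀)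
    (h1 : θ₀ < 1 / 2) (x : Fin n → Fin k) (c : ℝ) :
    ∫ Y, (correlation θ₀ x Y - c) ^ 2 ∂(condLaw n p θ₀ ε x) ≤
      3 / n.choose p +
        (snr θ₀ ε * ((∑ S : Hyperedge n p, edgeSignal x S) / n.choose p) - c) ^ 2 := by
  have h0 : 0 < θ₀ := hε.trans hθ
  have hN : (0 : ℝ) < n.choose p := by exact_mod_cast Nat.choose_pos hn
  have hv : 0 < θ₀ * (1 - θ₀) := mul_pos h0 (by linarith)
  have hs : 0 < √(θ₀ * (1 - θ₀)) := Real.sqrt_pos.2 hv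
  have hs2 : √(θ₀ * (1 - θ₀)) ^ 2 = θ₀ * (1 - θ₀) := Real.sq_sqrt hv.le
  set X : Hyperedge n p → Bool → ℝ := fun S b =>
    normalizedBit θ₀ b * (∏ s ∈ S.1, labelSign (x s)) / n.choose p with hX
  have hcorr : correlation θ₀ x = ∑ S, fun Y : Hypergraph n p => X S (Y S) := by
    ext Y
    rw [Finset.sum_apply, correlation, Finset.sum_div]
    rfl
  have hf := fun S : Hyperedge n p => abs_le.1 (abs_f_le_one hp (restrictLabels x S))
  have hq0 : ∀ S : Hyperedge n p, 0 ≤ θ₀ + ε * f (restrictLabels x S) := fun S => by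
    nlinarith [(hf S).1]
  have hq2 : ∀ S : Hyperedge n p, θ₀ + ε * f (restrictLabels x S) ≤ 2 * θ₀ := fun S => by
    nlinarith [(hf S).2]
  have hint : ∀ (S : Hyperedge n p) (g : Bool → ℝ),
      ∫ b, g b ∂(bern (θ₀ + ε * f (restrictLabels x S))) =
        (θ₀ + ε * f (restrictLabels x S)) * g true +
          (1 - (θ₀ + ε * f (restrictLabels x S))) * g false :=
    fun S g => integral_bern (hq0 S) (by linarith [hq2 S]) g
  have hmean : ∫ Y, correlation θ₀ x Y ∂(condLaw n p θ₀ ε x) =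
      snr θ₀ ε * ((∑ S : Hyperedge n p, edgeSignal x S) / n.choose p) := by
    rw [hcorr]
    simp only [Finset.sum_apply]
    rw [integral_finsetSum _ fun S _ => Integrable.of_finite, mul_div_assoc', Finset.mul_sum,
      Finset.sum_div]
    refine Finset.sum_congr rfl fun S _ => ?_
    have : ∫ Y, X S (Y S) ∂(condLaw n p θ₀ ε x) =
        ∫ b, X S b ∂(bern (θ₀ + ε * f (restrictLabels x S))) := by
      have := integral_comp_eval (X := fun _ : Hyperedge n p => Bool)
        (μ := fun S : Hyperedge n p => bern (θ₀ + ε * f (restrictLabels x S))) (i := S)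
        (f := X S) Integrable.of_finite.aestronglyMeasurable
      exact this
    rw [this, hint]
    simp only [hX, normalizedBit, if_true, Bool.false_eq_true, if_false, edgeSignal, snr]
    field_simp
    ring
  have hvar : Var[correlation θ₀ x; condLaw n p θ₀ ε x] ≤ 3 / n.choose p := by
    rw [hcorr, condLaw, variance_sum_pi fun S => MemLp.of_discrete]
    have hone : ∀ S : Hyperedge n p,
        Var[X S; bern (θ₀ + ε * f (restrictLabels x S))] ≤ 3 / (n.choose p : ℝ) ^ 2 := by
      intro S
      refine (variance_le_expectation_sq Integrable.of_finite.aestronglyMeasurable).trans ?_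
      rw [hint]
      have hχ : (∏ s ∈ S.1, labelSign (x s)) ^ 2 = 1 := by
        rw [← sq_abs, abs_prod_labelSign, one_pow]
      have hX2 : ∀ b, (X S ^ 2) b = normalizedBit θ₀ b ^ 2 / (n.choose p : ℝ) ^ 2 := by
        intro b
        simp only [hX, Pi.pow_apply, div_pow, mul_pow, hχ, mul_one]
      rw [hX2, hX2, mul_div_assoc', mul_div_assoc', ← add_div]
      gcongr
      simp only [normalizedBit, if_true, Bool.false_eq_true, if_false, div_pow, hs2]
      rw [mul_div_assoc', mul_div_assoc', ← add_div, div_le_iff₀ hv]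
      nlinarith [mul_nonneg h0.le (hq0 S), mul_nonneg h0.le (sub_nonneg.2 (hq2 S))]
    refine (Finset.sum_le_sum fun S _ => hone S).trans (le_of_eq ?_)
    simp only [Finset.sum_const, Finset.card_univ, card_hyperedge, nsmul_eq_mul]
    field_simp
  have hsub := variance_eq_sub (μ := condLaw n p θ₀ ε x) (X := fun Y => correlation θ₀ x Y - c)
    MemLp.of_discrete
  have hvc : Var[fun Y => correlation θ₀ x Y - c; condLaw n p θ₀ ε x] =
      Var[correlation θ₀ x; condLaw n p θ₀ ε x] :=
    variance_sub_const Integrable.of_finite.aestronglyMeasurable c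
  have hmc : ∫ Y, (correlation θ₀ x Y - c) ∂(condLaw n p θ₀ ε x) =
      snr θ₀ ε * ((∑ S : Hyperedge n p, edgeSignal x S) / n.choose p) - c := by
    rw [integral_sub Integrable.of_finite Integrable.of_finite, hmean]
    simp
  rw [hvc, hmc] at hsub
  have : ∫ Y, (correlation θ₀ x Y - c) ^ 2 ∂(condLaw n p θ₀ ε x) =
      ∫ Y, ((fun Y => correlation θ₀ x Y - c) ^ 2) Y ∂(condLaw n p θ₀ ε x) := rfl
  rw [this]
  linarith

lemma plantedLaw_real_apply (n k p : ℕ) (θ₀ ε : ℝ) (s : Set (Hypergraph n p)) :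
    (plantedLaw n k p θ₀ ε).real s =
      (∑ x : Fin n → Fin k, (condLaw n p θ₀ ε x).real s) / (k : ℝ) ^ n := by
  unfold plantedLaw Measure.real
  rw [Measure.finsetSum_apply, ENNReal.toReal_sum, Finset.sum_div]
  · refine Finset.sum_congr rfl fun x _ => ?_
    simp [div_eq_inv_mul]
  · intro x _
    have hk : k ≠ 0 ∨ n = 0 := by
      rcases Nat.eq_zero_or_pos n with h | h
      · exact Or.inr h
      · exact Or.inl (Fin.pos (x ⟨0, h⟩)).ne'
    rw [Measure.smul_apply, smul_eq_mul]
    refine ENNReal.mul_ne_top (ENNReal.inv_ne_top.2 ?_) (measure_ne_top _ _)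
    rcases hk with h | h
    · exact pow_ne_zero _ (by exact_mod_cast h)
    · simp [h]

/-- The largest eigenvalue dominates the correlation with any labelling. -/
lemma correlation_le_kikuchiMax {q ℓ : ℕ} (hn : 2 * q ≤ n) (hℓ : ℓ ≤ n) (θ₀ : ℝ)
    (x : Fin n → Fin k) (Y : Hypergraph n (2 * q)) :
    ((ℓ.choose q * (n - ℓ).descFactorial q : ℕ) : ℝ) * correlation θ₀ x Y ≤
      kikuchiMax ℓ θ₀ Y := by
  have := nonempty_tuples hℓ
  have hw : ∀ s, labelSign (x s) * labelSign (x s) = 1 := fun s => labelSign_mul_self _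
  have hR := dotProduct_mulVec_le_lambdaMax (kikuchi_edgeMatrix_isHermitian ℓ θ₀ Y)
    (fun T : Tuples n ℓ => ∏ a, labelSign (x (T a)))
  rw [quadratic_form_edgeMatrix (w := fun s => labelSign (x s)) hw hn] at hR
  have hvv : (fun T : Tuples n ℓ => ∏ a, labelSign (x (T a))) ⬝ᵥ
      (fun T : Tuples n ℓ => ∏ a, labelSign (x (T a))) = Fintype.card (Tuples n ℓ) := by
    simp only [dotProduct, ← Finset.prod_mul_distrib, hw, Finset.prod_const_one]
    simp
  rw [hvv] at hR
  have hc : (0 : ℝ) < Fintype.card (Tuples n ℓ) := by exact_mod_cast Fintype.card_pos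
  rw [kikuchiMax, kikuchi_tensor_eq, correlation]
  refine le_of_mul_le_mul_left ?_ hc
  linarith

/-- Under the planted law the largest eigenvalue is large with high probability. -/
lemma plantedLaw_kikuchiMax_le {q ℓ : ℕ} (hk : 2 ≤ k) (hq : 1 ≤ q) (hn : 2 * q ≤ n) (hℓ : ℓ ≤ n)
    {θ₀ ε : ℝ} (hε : 0 < ε) (hθ : ε < θ₀) (h1 : θ₀ < 1 / 2)
    (hd : 0 < ℓ.choose q * (n - ℓ).descFactorial q) :
    (plantedLaw n k (2 * q) θ₀ ε).real {Y | kikuchiMax ℓ θ₀ Y ≤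
        ((ℓ.choose q * (n - ℓ).descFactorial q : ℕ) : ℝ) *
          (snr θ₀ ε * signalStrength k (2 * q) / 2)} ≤
      4 / signalStrength k (2 * q) ^ 2 *
        (3 / (n.choose (2 * q) * snr θ₀ ε ^ 2) + 4 * ((2 * q : ℕ) : ℝ) ^ 2 / n) := by
  have hk0 : 0 < k := by omega
  have hβ := snr_pos hε hθ h1
  set β := snr θ₀ ε with hβdef
  have hM : 0 < signalStrength k (2 * q) := signalStrength_pos hk (even_two_mul q)
  set M := signalStrength k (2 * q) with hMdef
  have hkn : (0 : ℝ) < (k : ℝ) ^ n := by positivity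
  have hN : (0 : ℝ) < n.choose (2 * q) := by exact_mod_cast Nat.choose_pos hn
  have hd' : (0 : ℝ) < ((ℓ.choose q * (n - ℓ).descFactorial q : ℕ) : ℝ) := by exact_mod_cast hd
  rw [plantedLaw_real_apply]
  have hx : ∀ x : Fin n → Fin k, (condLaw n (2 * q) θ₀ ε x).real {Y | kikuchiMax ℓ θ₀ Y ≤
        ((ℓ.choose q * (n - ℓ).descFactorial q : ℕ) : ℝ) * (β * M / 2)} ≤
      4 / M ^ 2 * (3 / (n.choose (2 * q) * β ^ 2) +
        ((∑ S : Hyperedge n (2 * q), edgeSignal x S) / n.choose (2 * q) - M) ^ 2) := by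
    intro x
    have hmarkov := mul_meas_ge_le_integral_of_nonneg (μ := condLaw n (2 * q) θ₀ ε x)
      (f := fun Y => (correlation θ₀ x Y - β * M) ^ 2) (ae_of_all _ fun _ => sq_nonneg _)
      Integrable.of_finite ((β * M / 2) ^ 2)
    have hsub : (condLaw n (2 * q) θ₀ ε x).real {Y | kikuchiMax ℓ θ₀ Y ≤
        ((ℓ.choose q * (n - ℓ).descFactorial q : ℕ) : ℝ) * (β * M / 2)} ≤
        (condLaw n (2 * q) θ₀ ε x).real
          {Y | (β * M / 2) ^ 2 ≤ (correlation θ₀ x Y - β * M) ^ 2} := by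
      refine measureReal_mono fun Y hY => ?_
      have h2 := le_of_mul_le_mul_left
        ((correlation_le_kikuchiMax hn hℓ θ₀ x Y).trans hY) hd'
      have h3 : 0 < β * M := by positivity
      change (β * M / 2) ^ 2 ≤ (correlation θ₀ x Y - β * M) ^ 2
      nlinarith
    have h4 := hmarkov.trans (condLaw_mean_sq_le (by omega) hn hε hθ h1 x (β * M))
    have h5 : 0 < (β * M / 2) ^ 2 := by positivity
    refine hsub.trans ?_
    rw [mul_comm, ← le_div_iff₀ h5] at h4
    refine h4.trans (le_of_eq ?_)
    rw [← hβdef, ← mul_sub]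
    field_simp
    norm_num
  calc _ ≤ (∑ x : Fin n → Fin k, 4 / M ^ 2 * (3 / (n.choose (2 * q) * β ^ 2) +
        ((∑ S : Hyperedge n (2 * q), edgeSignal x S) / n.choose (2 * q) - M) ^ 2)) /
          (k : ℝ) ^ n := by
        gcongr with x _
        exact hx x
    _ = 4 / M ^ 2 * (3 / (n.choose (2 * q) * β ^ 2) + (∑ x : Fin n → Fin k,
        ((∑ S : Hyperedge n (2 * q), edgeSignal x S) / n.choose (2 * q) - M) ^ 2) /
          (k : ℝ) ^ n) := by
        rw [← Finset.mul_sum, Finset.sum_add_distrib]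
        simp only [Finset.sum_const, Finset.card_univ, Fintype.card_fun, Fintype.card_fin,
          nsmul_eq_mul]
        push_cast
        rw [mul_div_assoc, add_div, mul_div_cancel_left₀ _ hkn.ne']
    _ ≤ _ := by
        exact mul_le_mul_of_nonneg_left (add_le_add le_rfl
          (mean_sq_signal_sub_le hk0 (by omega) (even_two_mul q) hn)) (by positivity)

end Planted

end HSBM

namespace HSBM

/-! ### Asymptotics -/

lemma isProbabilityMeasure_plantedLaw (n k p : ℕ) (hk : 0 < k) (θ₀ ε : ℝ) :
    IsProbabilityMeasure (plantedLaw n k p θ₀ ε) := by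
  refine ⟨?_⟩
  have hkn : (k : ℝ) ^ n ≠ 0 := by positivity
  have h := plantedLaw_real_apply n k p θ₀ ε Set.univ
  simp only [probReal_univ, Finset.sum_const, Finset.card_univ, Fintype.card_fun,
    Fintype.card_fin, nsmul_eq_mul, mul_one, Nat.cast_pow, div_self hkn] at h
  exact (ENNReal.toReal_eq_one_iff _).1 h

lemma threshold_two_mul (C : ℝ) (n q ℓ : ℕ) (β : ℝ) :
    threshold C n (2 * q) ℓ β = 1 / 2 * C * β * ((n : ℝ) ^ q * (ℓ : ℝ) ^ q) := by
  have h : (((2 * q : ℕ) : ℝ)) / 2 = q := by push_cast; ring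
  rw [threshold, h, Real.rpow_natCast, Real.rpow_natCast]
  ring

lemma pow_le_two_pow_mul_descFactorial {m r N : ℕ} (h : N ≤ 2 * (m + 1 - r)) :
    N ^ r ≤ 2 ^ r * m.descFactorial r :=
  calc N ^ r ≤ (2 * (m + 1 - r)) ^ r := Nat.pow_le_pow_left h r
    _ = 2 ^ r * (m + 1 - r) ^ r := mul_pow _ _ _
    _ ≤ _ := Nat.mul_le_mul_left _ (Nat.pow_sub_le_descFactorial m r)

lemma pow_mul_pow_le_degree {n ℓ q : ℕ} (h1 : 2 * q ≤ ℓ) (h2 : 4 * ℓ ≤ n) :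
    n ^ q * ℓ ^ q ≤ 4 ^ q * q.factorial * (ℓ.choose q * (n - ℓ).descFactorial q) := by
  have hn : n ^ q ≤ 2 ^ q * (n - ℓ).descFactorial q :=
    pow_le_two_pow_mul_descFactorial (by omega)
  have hl : ℓ ^ q ≤ 2 ^ q * ℓ.descFactorial q := pow_le_two_pow_mul_descFactorial (by omega)
  rw [Nat.descFactorial_eq_factorial_mul_choose ℓ q] at hl
  calc _ ≤ (2 ^ q * (n - ℓ).descFactorial q) * (2 ^ q * (q.factorial * ℓ.choose q)) :=
        Nat.mul_le_mul hn hl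
    _ = (2 ^ q * 2 ^ q) * q.factorial * (ℓ.choose q * (n - ℓ).descFactorial q) := by ring
    _ = _ := by rw [← mul_pow]; norm_num

lemma pow_le_choose {n r : ℕ} (h : 2 * r ≤ n) :
    n ^ r ≤ 2 ^ r * r.factorial * n.choose r := by
  have := pow_le_two_pow_mul_descFactorial (m := n) (r := r) (N := n) (by omega)
  rwa [Nat.descFactorial_eq_factorial_mul_choose, ← mul_assoc] at this

lemma sq_threshold_ge {n ℓ q : ℕ} {C β : ℝ} (hn : 0 < n) (hℓ : 0 < ℓ) (hC : 0 < C)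
    (h : 3 * √6 / C * (ℓ : ℝ) ^ ((1 : ℝ) / 2 - ((2 * q : ℕ) : ℝ) / 4) *
      (n : ℝ) ^ (-((2 * q : ℕ) : ℝ) / 4) * √(Real.log n) ≤ β) :
    6 * ((n : ℝ) ^ q * (ℓ : ℝ) ^ q) * (ℓ * Real.log n) ≤
      (C / 3 * β * ((n : ℝ) ^ q * (ℓ : ℝ) ^ q)) ^ 2 := by
  have hn0 : (0 : ℝ) < n := by exact_mod_cast hn
  have hℓ0 : (0 : ℝ) < ℓ := by exact_mod_cast hℓ
  have hlog : 0 ≤ Real.log n := Real.log_natCast_nonneg n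
  set a := (ℓ : ℝ) ^ ((1 : ℝ) / 2 - ((2 * q : ℕ) : ℝ) / 4) with ha
  set b := (n : ℝ) ^ (-((2 * q : ℕ) : ℝ) / 4) with hb
  have ha0 : 0 < a := Real.rpow_pos_of_pos hℓ0 _
  have hb0 : 0 < b := Real.rpow_pos_of_pos hn0 _
  have ha2 : a ^ 2 * (ℓ : ℝ) ^ q = ℓ := by
    rw [ha, ← Real.rpow_natCast, ← Real.rpow_natCast, ← Real.rpow_mul hℓ0.le,
      ← Real.rpow_add hℓ0]
    conv_rhs => rw [← Real.rpow_one (ℓ : ℝ)]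
    congr 1
    push_cast
    ring
  have hb2 : b ^ 2 * (n : ℝ) ^ q = 1 := by
    rw [hb, ← Real.rpow_natCast, ← Real.rpow_natCast, ← Real.rpow_mul hn0.le,
      ← Real.rpow_add hn0]
    conv_rhs => rw [← Real.rpow_zero (n : ℝ)]
    congr 1
    push_cast
    ring
  have h1 : √6 * a * b * √(Real.log n) ≤ C / 3 * β := by
    have := mul_le_mul_of_nonneg_left h (by positivity : 0 ≤ C / 3)
    refine le_trans (le_of_eq ?_) this
    field_simp
  have h2 : (√6 * a * b * √(Real.log n)) ^ 2 ≤ (C / 3 * β) ^ 2 :=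
    pow_le_pow_left₀ (by positivity) h1 2
  rw [mul_pow, mul_pow, mul_pow, Real.sq_sqrt (by norm_num), Real.sq_sqrt hlog] at h2
  calc 6 * ((n : ℝ) ^ q * (ℓ : ℝ) ^ q) * (ℓ * Real.log n)
      = 6 * ((n : ℝ) ^ q * (ℓ : ℝ) ^ q) * ((a ^ 2 * (ℓ : ℝ) ^ q) * (b ^ 2 * (n : ℝ) ^ q) *
          Real.log n) := by rw [ha2, hb2, mul_one]
    _ = 6 * a ^ 2 * b ^ 2 * Real.log n * ((n : ℝ) ^ q * (ℓ : ℝ) ^ q) ^ 2 := by ring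
    _ ≤ (C / 3 * β) ^ 2 * ((n : ℝ) ^ q * (ℓ : ℝ) ^ q) ^ 2 := by gcongr
    _ = _ := by ring

lemma eventually_four_mul_le {ℓ : ℕ → ℕ}
    (h : (fun n => (ℓ n : ℝ)) =o[atTop] fun n : ℕ => √(n : ℝ)) :
    ∀ᶠ n in atTop, 4 * ℓ n ≤ n := by
  filter_upwards [h.bound (by norm_num : (0 : ℝ) < 1 / 4), eventually_ge_atTop 1] with n hn h1
  have hn1 : (1 : ℝ) ≤ n := by exact_mod_cast h1
  rw [Real.norm_of_nonneg (by positivity), Real.norm_of_nonneg (by positivity)] at hn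
  have hs : √(n : ℝ) ≤ n := by
    rw [Real.sqrt_le_left (by linarith)]
    nlinarith
  have : (4 : ℝ) * ℓ n ≤ n := by linarith
  exact_mod_cast this

/-- The null error probability vanishes. -/
lemma tendsto_null_error {q : ℕ} {C : ℝ} (hC : 0 < C) (hCq : C * q.factorial ≤ 1)
    {θ₀ ε : ℕ → ℝ} {ℓ : ℕ → ℕ} (hP : ParamConds (2 * q) θ₀ ε ℓ)
    (hβ : ∀ᶠ n : ℕ in atTop,
      3 * √6 / C * (ℓ n : ℝ) ^ ((1 : ℝ) / 2 - ((2 * q : ℕ) : ℝ) / 4) *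
        (n : ℝ) ^ (-((2 * q : ℕ) : ℝ) / 4) * √(Real.log n) ≤ snr (θ₀ n) (ε n)) :
    Tendsto (fun n : ℕ => (nullLaw n (2 * q) (θ₀ n)).real
      {Y | 2 / 3 * threshold C n (2 * q) (ℓ n) (snr (θ₀ n) (ε n)) ≤ kikuchiMax (ℓ n) (θ₀ n) Y})
      atTop (𝓝 0) := by
  have hlim : Tendsto (fun n : ℕ => Real.exp (-(Real.log n / 2))) atTop (𝓝 0) :=
    Real.tendsto_exp_neg_atTop_nhds_zero.comp
      ((Real.tendsto_log_atTop.comp tendsto_natCast_atTop_atTop).atTop_div_const two_pos)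
  refine tendsto_of_tendsto_of_tendsto_of_le_of_le' tendsto_const_nhds hlim
    (Eventually.of_forall fun n => measureReal_nonneg) ?_
  filter_upwards [hP.theta_lt, hP.eps_pos, hP.eps_lt, hβ, eventually_four_mul_le hP.ell_small,
    hP.ell_large.eventually_ge_atTop 1] with n h1 hε hθ hβn h4 hℓ1
  have ht : 2 / 3 * threshold C n (2 * q) (ℓ n) (snr (θ₀ n) (ε n)) =
      C / 3 * snr (θ₀ n) (ε n) * ((n : ℝ) ^ q * (ℓ n : ℝ) ^ q) := by
    rw [threshold_two_mul]; ring
  refine (nullLaw_kikuchiMax_le hε hθ h1 (by omega) hℓ1 hC hCq ht ?_).trans ?_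
  · rw [ht]
    exact sq_threshold_ge (by omega) hℓ1 hC hβn
  · refine Real.exp_le_exp.2 ?_
    have hlog : 0 ≤ Real.log n := Real.log_natCast_nonneg n
    have : (1 : ℝ) ≤ ℓ n := by exact_mod_cast hℓ1
    nlinarith

/-- The planted error probability vanishes. -/
lemma tendsto_planted_error {k q : ℕ} (hk : 2 ≤ k) (hq : 1 ≤ q) {C : ℝ}
    (hC : C = 3 / 4 * (1 / (4 ^ q * q.factorial)) * signalStrength k (2 * q))
    {θ₀ ε : ℕ → ℝ} {ℓ : ℕ → ℕ} (hP : ParamConds (2 * q) θ₀ ε ℓ) :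
    Tendsto (fun n : ℕ => (plantedLaw n k (2 * q) (θ₀ n) (ε n)).real
      {Y | kikuchiMax (ℓ n) (θ₀ n) Y ≤ 4 / 3 * threshold C n (2 * q) (ℓ n) (snr (θ₀ n) (ε n))})
      atTop (𝓝 0) := by
  have hM : 0 < signalStrength k (2 * q) := signalStrength_pos hk (even_two_mul q)
  set M := signalStrength k (2 * q) with hMdef
  obtain ⟨K, hK, hKb⟩ := hP.snr_lower.exists_pos
  have hKb := hKb.bound
  set R : ℝ := 4 / M ^ 2 * (3 * (K ^ 2 * (2 ^ (2 * q) * (2 * q).factorial)) +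
    4 * ((2 * q : ℕ) : ℝ) ^ 2) with hR
  have hlim : Tendsto (fun n : ℕ => R / n) atTop (𝓝 0) := tendsto_const_div_atTop_nhds_zero_nat R
  refine tendsto_of_tendsto_of_tendsto_of_le_of_le' tendsto_const_nhds hlim
    (Eventually.of_forall fun n => measureReal_nonneg) ?_
  filter_upwards [hP.theta_lt, hP.eps_pos, hP.eps_lt, hKb, eventually_four_mul_le hP.ell_small,
    hP.ell_large.eventually_ge_atTop (2 * q)] with n h1 hε hθ hKn h4 hℓ
  have hβ := snr_pos hε hθ h1
  set β := snr (θ₀ n) (ε n) with hβdef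
  have hn : 0 < n := by omega
  have hn0 : (0 : ℝ) < n := by exact_mod_cast hn
  have := isProbabilityMeasure_plantedLaw n k (2 * q) (by omega) (θ₀ n) (ε n)
  have hdeg := pow_mul_pow_le_degree hℓ h4
  have hℓ0 : 0 < ℓ n := by omega
  have hdpos : 0 < (ℓ n).choose q * (n - ℓ n).descFactorial q := by
    refine Nat.pos_of_ne_zero fun h0 => ?_
    rw [h0, mul_zero] at hdeg
    have : 0 < n ^ q * ℓ n ^ q := by positivity
    omega
  have hdeg' : (n : ℝ) ^ q * (ℓ n : ℝ) ^ q ≤ 4 ^ q * q.factorial *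
      (((ℓ n).choose q * (n - ℓ n).descFactorial q : ℕ) : ℝ) := by exact_mod_cast hdeg
  have hsub : (plantedLaw n k (2 * q) (θ₀ n) (ε n)).real
      {Y | kikuchiMax (ℓ n) (θ₀ n) Y ≤ 4 / 3 * threshold C n (2 * q) (ℓ n) β} ≤
      (plantedLaw n k (2 * q) (θ₀ n) (ε n)).real {Y | kikuchiMax (ℓ n) (θ₀ n) Y ≤
        (((ℓ n).choose q * (n - ℓ n).descFactorial q : ℕ) : ℝ) * (β * M / 2)} := by
    refine measureReal_mono fun Y hY => Set.mem_ofPred.2 (le_trans hY ?_)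
    rw [threshold_two_mul, hC]
    have hf : (0 : ℝ) < 4 ^ q * q.factorial := by positivity
    calc _ = ((n : ℝ) ^ q * (ℓ n : ℝ) ^ q) / (4 ^ q * q.factorial) * (β * M / 2) := by
          field_simp
      _ ≤ _ := by
          gcongr
          rw [div_le_iff₀ hf]
          linarith
  refine hsub.trans ((plantedLaw_kikuchiMax_le hk hq (by omega) (by omega) hε hθ h1 hdpos).trans ?_)
  have hN : (0 : ℝ) < n.choose (2 * q) := by
    exact_mod_cast Nat.choose_pos (by omega)
  have hchoose : (n : ℝ) ^ (2 * q) ≤ 2 ^ (2 * q) * (2 * q).factorial * n.choose (2 * q) := by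
    exact_mod_cast pow_le_choose (by omega)
  have hsq : (n : ℝ) ≤ K ^ 2 * β ^ 2 * (n : ℝ) ^ (2 * q) := by
    rw [Real.norm_of_nonneg (by positivity), Real.norm_of_nonneg hβ.le] at hKn
    have h2 := pow_le_pow_left₀ (by positivity) hKn 2
    have h3 : ((n : ℝ) ^ ((1 : ℝ) / 2 - ((2 * q : ℕ) : ℝ) / 2)) ^ 2 * (n : ℝ) ^ (2 * q) = n := by
      rw [← Real.rpow_natCast, ← Real.rpow_natCast, ← Real.rpow_mul hn0.le, ← Real.rpow_add hn0]
      conv_rhs => rw [← Real.rpow_one (n : ℝ)]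
      congr 1
      push_cast
      ring
    calc (n : ℝ) = ((n : ℝ) ^ ((1 : ℝ) / 2 - ((2 * q : ℕ) : ℝ) / 2)) ^ 2 * (n : ℝ) ^ (2 * q) :=
          h3.symm
      _ ≤ (K * β) ^ 2 * (n : ℝ) ^ (2 * q) := by gcongr
      _ = _ := by ring
  have hfrac : 3 / (n.choose (2 * q) * β ^ 2) ≤
      3 * (K ^ 2 * (2 ^ (2 * q) * (2 * q).factorial)) / n := by
    rw [div_le_div_iff₀ (by positivity) hn0]
    have h5 : (n : ℝ) ≤ K ^ 2 * β ^ 2 * (2 ^ (2 * q) * (2 * q).factorial * n.choose (2 * q)) :=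
      hsq.trans (by gcongr)
    linarith
  calc _ ≤ 4 / M ^ 2 * (3 * (K ^ 2 * (2 ^ (2 * q) * (2 * q).factorial)) / n +
        4 * ((2 * q : ℕ) : ℝ) ^ 2 / n) :=
        mul_le_mul_of_nonneg_left (add_le_add hfrac le_rfl) (by positivity)
    _ = R / n := by rw [hR]; ring

/-- If the complements of `A n` are eventually covered by sets of vanishing probability, then
the probability of `A n` tends to one. -/
lemma tendsto_one_of_compl_subset {Ω : ℕ → Type*} [∀ n, MeasurableSpace (Ω n)]
    (μ : ∀ n, Measure (Ω n)) [∀ n, IsProbabilityMeasure (μ n)] {A B : ∀ n, Set (Ω n)}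
    (hAB : ∀ᶠ n in atTop, ∀ ω, ω ∉ B n → ω ∈ A n)
    (hB : Tendsto (fun n => (μ n).real (B n)) atTop (𝓝 0)) :
    Tendsto (fun n => (μ n).real (A n)) atTop (𝓝 1) := by
  have h1 : Tendsto (fun n => 1 - (μ n).real (B n)) atTop (𝓝 1) := by
    simpa using tendsto_const_nhds.sub hB
  refine tendsto_of_tendsto_of_tendsto_of_le_of_le' h1 tendsto_const_nhds ?_
    (Eventually.of_forall fun n => measureReal_le_one)
  filter_upwards [hAB] with n hn
  have hu : (Set.univ : Set (Ω n)) ⊆ A n ∪ B n := fun ω _ => by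
    by_cases h : ω ∈ B n
    exacts [Or.inr h, Or.inl (hn ω h)]
  have h2 := (measureReal_mono (μ := μ n) hu).trans (measureReal_union_le (A n) (B n))
  rw [probReal_univ] at h2
  linarith

end HSBM

theorem mainTheorem1 (p k : ℕ) (hp : 2 ≤ p) (hpe : Even p) (hk : 2 ≤ k) :
    ∃ C : ℝ, 0 < C ∧
      ∀ (θ₀ ε : ℕ → ℝ) (ℓ : ℕ → ℕ), HSBM.ParamConds p θ₀ ε ℓ →
        (∀ᶠ n : ℕ in atTop,
          3 * √6 / C * (ℓ n : ℝ) ^ ((1 : ℝ) / 2 - (p : ℝ) / 4) * (n : ℝ) ^ (-(p : ℝ) / 4)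
            * √(Real.log n) ≤ HSBM.snr (θ₀ n) (ε n)) →
        Tendsto (fun n : ℕ =>
          max
            ((HSBM.nullLaw n p (θ₀ n)).real
              {Y | 2 / 3 * HSBM.threshold C n p (ℓ n) (HSBM.snr (θ₀ n) (ε n))
                ≤ HSBM.kikuchiMax (ℓ n) (θ₀ n) Y})
            ((HSBM.plantedLaw n k p (θ₀ n) (ε n)).real
              {Y | HSBM.kikuchiMax (ℓ n) (θ₀ n) Y
                ≤ 4 / 3 * HSBM.threshold C n p (ℓ n) (HSBM.snr (θ₀ n) (ε n))}))
          atTop (𝓝 0) ∧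
        -- thresholding, at `τ`, any estimate of the largest eigenvalue with additive error at
        -- most `τ / 3` or relative error at most `1 / 4` solves detection
        ∀ est : ∀ n : ℕ, HSBM.Hypergraph n p → ℝ,
          (∀ᶠ n : ℕ in atTop, ∀ Y : HSBM.Hypergraph n p,
            |est n Y - HSBM.kikuchiMax (ℓ n) (θ₀ n) Y|
                ≤ 1 / 3 * HSBM.threshold C n p (ℓ n) (HSBM.snr (θ₀ n) (ε n)) ∨
            |est n Y - HSBM.kikuchiMax (ℓ n) (θ₀ n) Y|
                ≤ 1 / 4 * |HSBM.kikuchiMax (ℓ n) (θ₀ n) Y|) →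
          HSBM.SolvesDetection k p θ₀ ε fun n Y =>
            decide (est n Y ≤ HSBM.threshold C n p (ℓ n) (HSBM.snr (θ₀ n) (ε n))) := by
  obtain ⟨q, rfl⟩ := hpe.two_dvd
  have hq : 1 ≤ q := by omega
  have hM := HSBM.signalStrength_pos hk hpe
  have hM1 := HSBM.signalStrength_le_one (k := k) (by omega) hp
  obtain ⟨C, hCdef⟩ : ∃ C : ℝ, C = 3 / 4 * (1 / (4 ^ q * q.factorial)) *
    HSBM.signalStrength k (2 * q) := ⟨_, rfl⟩
  have hC : 0 < C := by rw [hCdef]; positivity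
  have hCq : C * q.factorial ≤ 1 := by
    have h4 : (1 : ℝ) ≤ 4 ^ q := one_le_pow₀ (by norm_num)
    have : C * q.factorial = 3 / 4 * HSBM.signalStrength k (2 * q) / 4 ^ q := by
      rw [hCdef]
      field_simp
    rw [this, div_le_one (by positivity)]
    linarith
  refine ⟨C, hC, fun θ₀ ε ℓ hP hβ => ?_⟩
  have hnull := HSBM.tendsto_null_error hC hCq hP hβ
  have hplant := HSBM.tendsto_planted_error hk hq hCdef hP
  refine ⟨by simpa using hnull.max hplant, fun est hest => ?_⟩
  have hτ : ∀ᶠ n in atTop,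
      0 ≤ HSBM.threshold C n (2 * q) (ℓ n) (HSBM.snr (θ₀ n) (ε n)) := by
    filter_upwards [hP.theta_lt, hP.eps_pos, hP.eps_lt] with n h1 hε hθ
    have := HSBM.snr_pos hε hθ h1
    rw [HSBM.threshold_two_mul]
    positivity
  refine ⟨HSBM.tendsto_one_of_compl_subset _ ?_ hnull, ?_⟩
  · filter_upwards [hest, hτ] with n hn hτn Y hY
    simp only [not_le, decide_eq_true_eq] at hY ⊢
    rcases hn Y with h | h
    · linarith [(abs_le.1 h).2]
    · have h2 := (abs_le.1 h).2
      rcases abs_cases (HSBM.kikuchiMax (ℓ n) (θ₀ n) Y) with ⟨h3, _⟩ | ⟨h3, _⟩ <;>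
        rw [h3] at h2 <;> linarith
  · have := fun n => HSBM.isProbabilityMeasure_plantedLaw n k (2 * q) (by omega) (θ₀ n) (ε n)
    refine HSBM.tendsto_one_of_compl_subset
      (fun n => HSBM.plantedLaw n k (2 * q) (θ₀ n) (ε n)) ?_ hplant
    filter_upwards [hest, hτ] with n hn hτn Y hY
    simp only [not_le, decide_eq_false_iff_not] at hY ⊢
    rcases hn Y with h | h
    · linarith [(abs_le.1 h).1]
    · have h2 := (abs_le.1 h).1
      rw [abs_of_nonneg (by linarith)] at h2
      linarith
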